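/- For $0\le r\le R$ write $A(r,R)=\{z\in\mathbb C: r<|z|<R\}$. For $0<r<R<\infty$ this round annulus is the standard cylinder of finite modulus; its boundary $\partial A(r,R)$ consists of the circles $|z|=r$ and $|z|=R$. A topological annulus is an open set $U\subset\mathbb C$ homeomorphic to a round annulus. Its modulus $\operatorname{mod}(U)$ is the number $m>0$ such that $U$ is conformally equivalent to $A(1,e^{m})$ (so $\operatorname{mod}(A(r,R))=\log(R/r)$ for $0<r<R$). A set $U\subset A$ is homotopically non-trivial (essential) in $A$ if the inclusion $U\hookrightarrow A$ is not homotopic to a constant map. **Lemma 9 (Definite Grötzsch Inequality).** There is a universal function $\beta:\mathbb R\to\mathbb R$ with $\beta(0)=0$ and $\beta(x)>0$ for all $x>0$ such that the following holds. Let $A=A(r,R)$ with $0<r<R<\infty$, and let $A_1,A_2\subset A$ be disjoint topological annuli that are homotopically non-trivial in $A$. Let $K$ be the set of points of $A\setminus(A_1\cup A_2)$ which $A_1\cup A_2$ separates from $\partial A$, that is, whose connected component in $\overline A\setminus(A_1\cup A_2)$ does not meet $\partial A$. Let $\operatorname{mod}(K)$ be the modulus of the smallest concentric sub-cylinder $\{a\le|z|\le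 b\}$ of $A$ containing $K$, that is, $\operatorname{mod}(K)=\log(b/a)$ with $a=\min_{z\in K}|z|$ and $b=\max_{z\in K}|z|$ (so $\operatorname{mod}(K)=0$ exactly when $K$ is a circle $|z|=a$). Then $$\operatorname{mod}(A)\ \ge\ \operatorname{mod}(A_1)+\operatorname{mod}(A_2)+\beta(\operatorname{mod}(K)).$$ -/

import Mathlib

/-- The round annulus `{z : r < |z| < R}`. For `0 < r < R` this is the standard cylinder of
finite modulus `log (R / r)`, with boundary the two circles `|z| = r` and `|z| = R`; its
concentric sub-cylinders are the annuli `a < |z| < b` (or `a ≤ |z| ≤ b`) inside it. -/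
def roundAnnulus (r R : ℝ) : Set ℂ := {z | r < ‖z‖ ∧ ‖z‖ < R}

/-- Two open subsets of the plane are conformally equivalent if a holomorphic map sends the first
bijectively onto the second (its inverse is then holomorphic as well). -/
def ConformallyEquivalent (U V : Set ℂ) : Prop :=
  ∃ f : ℂ → ℂ, DifferentiableOn ℂ f U ∧ Set.BijOn f U V

/-- The conformal modulus of a plane annulus `U`: the number `m > 0` such that `U` is conformally
equivalent to `{1 < |z| < exp m}`. There is at most one such `m`, so the supremum only picks it
out; the value is `0` for a set that is not conformally an annulus of finite modulus, such as the
empty set. -/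
noncomputable def annulusModulus (U : Set ℂ) : ℝ :=
  sSup {m : ℝ | 0 < m ∧ ConformallyEquivalent (roundAnnulus 1 (Real.exp m)) U}

/-- A topological annulus in the plane: an open set homeomorphic to a round annulus. -/
def IsTopologicalAnnulus (U : Set ℂ) : Prop :=
  IsOpen U ∧ Nonempty (U ≃ₜ roundAnnulus 1 2)

/-- `U` is homotopically non-trivial (essential) in `A`: it is contained in `A`, and the inclusion
map is not homotopic in `A` to a constant map. -/
def IsHomotopicallyNontrivialIn (U A : Set ℂ) : Prop :=
  ∃ h : U ⊆ A, ¬ (ContinuousMap.inclusion h).Nullhomotopic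

/-- The points of `A \ S` that `S` separates from the boundary of `A`: their connected component
in the complement of `S` in the closure of `A` does not meet the boundary of `A`. -/
def separatedPart (A S : Set ℂ) : Set ℂ :=
  {z | z ∈ A \ S ∧ Disjoint (connectedComponentIn (closure A \ S) z) (frontier A)}

/-- The modulus `mod K` of a non-empty compact subset `K` of a round annulus centred at `0`: the
modulus of the smallest concentric sub-cylinder `a ≤ |z| ≤ b` containing `K`, that is
`a = min |z|` and `b = max |z|` over `z ∈ K`. It is `0` if `a = b`. -/
noncomputable def concentricModulus (K : Set ℂ) : ℝ :=
  annulusModulus (roundAnnulus (sInf (norm '' K)) (sSup (norm '' K)))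

/-! The proof is a length–area argument. In a conformal annulus of modulus `m` that is essential in
`A`, the images of the concentric circles wind around 0, so they have length at least 2π in the
metric |dz|/|z|. Integrating over this family bounds 2πm by the area of the annulus in that metric.
Adding the areas of two disjoint annuli gives the ordinary Grötzsch inequality.

For the deficit, choose k, k' in K with ‖k'‖ ≥ e^g ‖k‖, where g is half of mod K, and multiply the
metric by σ = `shrinkFactor g` in the middle half of the band ‖k‖ < |z| < e^g ‖k‖. The area of A
drops by 2π · (g/2)(1 - σ²), and this is the gain provided that no core curve becomes shorter than
2π. That holds if every core curve leaves the band: a curve meeting the middle half then varies by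
at least g/4 in log |z|, so its logarithmic length is at least 2√(π² + (g/4)²)
(`HasWinding.le_lintegral`), which exactly pays for σ.

That core curves leave the band is topology (`IsAnnularChart.exists_norm_le_or_le_norm`). A core
curve confined to ‖k‖ < |z| < ‖k'‖ winds around k as it does around 0, and not at all around k'. One
can then find exponents with a + a' ≠ 0 such that (z - k)^a (z - k')^a' z^b has winding number zero
along the core curves of both annuli, hence a continuous logarithm on their union S. As S separates
k and k' from the boundary, the function could be altered there to a continuous nonvanishing
function on ℂ \ {0}. Its winding numbers along |z| = r and |z| = R would then agree, but they are b
and a + a' + b (`not_exists_log_of_mem_separatedPart`). -/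

/-! ### Continuous logarithms and winding numbers. -/

open Complex in
theorem exists_continuous_log {X : Type*} [TopologicalSpace X] [SimplyConnectedSpace X]
    [LocallyPathConnectedSpace X] {g : X → ℂ} (hg : Continuous g) (h0 : ∀ x, g x ≠ 0) :
    ∃ G : X → ℂ, Continuous G ∧ ∀ x, exp (G x) = g x := by
  obtain ⟨a⟩ : Nonempty X := inferInstance
  obtain ⟨F, ⟨-, hF⟩, -⟩ := Complex.isCoveringMapOn_exp.existsUnique_continuousMap_lifts
    ⟨g, hg⟩ (a₀ := a) (e₀ := log (g a)) (by simp [exp_log (h0 a)]) (fun x => by simpa using h0 x)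
  exact ⟨F, F.continuous, fun x => congrFun hF x⟩

/-- A continuous logarithm of `1` on a connected space is constant. -/
theorem exists_int_of_exp_eq_one {X : Type*} [TopologicalSpace X] [PreconnectedSpace X]
    {d : X → ℂ} (hd : Continuous d) (h1 : ∀ x, Complex.exp (d x) = 1) :
    ∃ n : ℤ, ∀ x, d x = n * (2 * Real.pi * Complex.I) := by
  rcases isEmpty_or_nonempty X with hX | ⟨⟨a⟩⟩
  · exact ⟨0, fun x => isEmptyElim x⟩
  choose k hk using fun x => Complex.exp_eq_one_iff.1 (h1 x)
  have hkc : Continuous k := by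
    refine Int.isClosedEmbedding_coe_real.isInducing.continuous_iff.2 ?_
    have : ((fun n : ℤ => (n : ℝ)) ∘ k) = fun x => (d x).im / (2 * Real.pi) := by
      ext x
      have := Real.pi_pos
      rw [hk x]
      simp
    rw [this]
    fun_prop
  refine ⟨k a, fun x => ?_⟩
  rw [hk x, PreconnectedSpace.constant inferInstance hkc (x := x) (y := a)]

/-- The curve `γ`, of period `2π`, avoids the origin and has winding number `n` about it. -/
def HasWinding (γ : ℝ → ℂ) (n : ℤ) : Prop :=
  ∃ G : ℝ → ℂ, Continuous G ∧ (∀ y, Complex.exp (G y) = γ y) ∧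
    ∀ y, G (y + 2 * Real.pi) = G y + n * (2 * Real.pi * Complex.I)

theorem two_pi_I_ne_zero : (2 * Real.pi * Complex.I : ℂ) ≠ 0 := by
  simp [Real.pi_ne_zero]

namespace HasWinding

variable {γ δ : ℝ → ℂ} {m n : ℤ}

theorem unique (hm : HasWinding γ m) (hn : HasWinding γ n) : m = n := by
  obtain ⟨G, hG, hGe, hGp⟩ := hm
  obtain ⟨H, hH, hHe, hHp⟩ := hn
  obtain ⟨k, hk⟩ := exists_int_of_exp_eq_one (d := fun y => G y - H y) (hG.sub hH) (fun y => by
    rw [Complex.exp_sub, hGe, hHe, div_self]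
    rw [← hGe]; exact Complex.exp_ne_zero _)
  have h0 := hk 0
  have h1 := hk (0 + 2 * Real.pi)
  simp only [hGp, hHp] at h0 h1
  have : ((m : ℂ) - n) * (2 * Real.pi * Complex.I) = 0 := by linear_combination h1 - h0
  have := (mul_eq_zero.1 this).resolve_right two_pi_I_ne_zero
  exact_mod_cast sub_eq_zero.1 this

theorem mul (hm : HasWinding γ m) (hn : HasWinding δ n) :
    HasWinding (fun y => γ y * δ y) (m + n) := by
  obtain ⟨G, hG, hGe, hGp⟩ := hm
  obtain ⟨H, hH, hHe, hHp⟩ := hn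
  refine ⟨fun y => G y + H y, hG.add hH, fun y => ?_, fun y => ?_⟩
  · rw [Complex.exp_add, hGe, hHe]
  · simp only [hGp, hHp]; push_cast; ring

theorem zpow (hm : HasWinding γ m) (k : ℤ) : HasWinding (fun y => γ y ^ k) (k * m) := by
  obtain ⟨G, hG, hGe, hGp⟩ := hm
  refine ⟨fun y => k * G y, by fun_prop, fun y => ?_, fun y => ?_⟩
  · rw [Complex.exp_int_mul, hGe]
  · simp only [hGp]; push_cast; ring

theorem const {c : ℂ} (hc : c ≠ 0) : HasWinding (fun _ => c) 0 :=
  ⟨fun _ => Complex.log c, continuous_const, fun _ => Complex.exp_log hc, by simp⟩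

theorem ne_zero (hm : HasWinding γ m) (y : ℝ) : γ y ≠ 0 := by
  obtain ⟨G, -, hGe, -⟩ := hm
  rw [← hGe]; exact Complex.exp_ne_zero _

theorem continuous (hm : HasWinding γ m) : Continuous γ := by
  obtain ⟨G, hG, hGe, -⟩ := hm
  rw [← funext hGe]; fun_prop

theorem periodic (hm : HasWinding γ m) (y : ℝ) : γ (y + 2 * Real.pi) = γ y := by
  obtain ⟨G, hG, hGe, hGp⟩ := hm
  rw [← hGe, ← hGe, hGp, Complex.exp_add, Complex.exp_int_mul_two_pi_mul_I, mul_one]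

/-- Curves that are closer to each other than to the origin have the same winding number. -/
theorem of_near (hm : HasWinding γ m) (hδ : Continuous δ)
    (hp : ∀ y, δ (y + 2 * Real.pi) = δ y) (h : ∀ y, ‖δ y - γ y‖ < ‖γ y‖) : HasWinding δ m := by
  have h0 := hm.ne_zero
  have hc := hm.continuous
  have hper := hm.periodic
  obtain ⟨G, hG, hGe, hGp⟩ := hm
  have hs : ∀ y, δ y / γ y ∈ Complex.slitPlane := by
    intro y
    have : δ y / γ y = 1 + (δ y - γ y) / γ y := by have := h0 y; field_simp; ring
    rw [this]
    apply Complex.mem_slitPlane_of_norm_lt_one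
    rw [norm_div, div_lt_one (norm_pos_iff.2 (h0 y))]
    exact h y
  -- The ratio stays in the unit disc around 1, so its principal logarithm is continuous and
  -- periodic and adds no winding.
  refine ⟨fun y => G y + Complex.log (δ y / γ y), ?_, fun y => ?_, fun y => ?_⟩
  · exact hG.add ((hδ.div hc h0).clog hs)
  · rw [Complex.exp_add, hGe, Complex.exp_log (Complex.slitPlane_ne_zero (hs y)),
      mul_div_cancel₀ _ (h0 y)]
  · simp only [hGp, hp, hper]; ring

end HasWinding

/-- A nonvanishing function on a cylinder has the same winding number along all circles. -/
theorem exists_winding_lift {g : ℝ × ℝ → ℂ} (hg : Continuous g) (h0 : ∀ p, g p ≠ 0)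
    (hp : ∀ s y, g (s, y + 2 * Real.pi) = g (s, y)) :
    ∃ (G : ℝ × ℝ → ℂ) (n : ℤ), Continuous G ∧ (∀ p, Complex.exp (G p) = g p) ∧
      (∀ s y, G (s, y + 2 * Real.pi) = G (s, y) + n * (2 * Real.pi * Complex.I)) ∧
      ∀ s, HasWinding (fun y => g (s, y)) n := by
  obtain ⟨G, hG, hGe⟩ := exists_continuous_log hg h0
  obtain ⟨n, hn⟩ := exists_int_of_exp_eq_one
    (d := fun p : ℝ × ℝ => G (p.1, p.2 + 2 * Real.pi) - G p) (by fun_prop) (fun p => by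
      rw [Complex.exp_sub, hGe, hGe, hp, div_self (h0 _)])
  have hper : ∀ s y, G (s, y + 2 * Real.pi) = G (s, y) + n * (2 * Real.pi * Complex.I) :=
    fun s y => by linear_combination hn (s, y)
  exact ⟨G, n, hG, hGe, hper, fun s => ⟨fun y => G (s, y), by fun_prop, fun y => hGe _, hper s⟩⟩

/-! ### Topological cylinders and their charts. -/

/-- `Φ` presents the open set `U` as the quotient of `ℝ × ℝ` by the translation by `2π` in the
second variable, that is, as a topological cylinder. -/
structure IsAnnularChart (Φ : ℝ × ℝ → ℂ) (U : Set ℂ) : Prop where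
  continuous : Continuous Φ
  isOpenMap : IsOpenMap Φ
  range_eq : Set.range Φ = U
  eq_iff : ∀ p q, Φ p = Φ q ↔ ∃ n : ℤ, q = (p.1, p.2 + n * (2 * Real.pi))

namespace IsAnnularChart

variable {Φ : ℝ × ℝ → ℂ} {U : Set ℂ}

theorem mem (hΦ : IsAnnularChart Φ U) (p : ℝ × ℝ) : Φ p ∈ U := hΦ.range_eq ▸ Set.mem_range_self p

theorem isOpen (hΦ : IsAnnularChart Φ U) : IsOpen U := hΦ.range_eq ▸ hΦ.isOpenMap.isOpen_range

theorem periodic (hΦ : IsAnnularChart Φ U) (s y : ℝ) : Φ (s, y + 2 * Real.pi) = Φ (s, y) :=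
  ((hΦ.eq_iff _ _).2 ⟨1, by simp⟩).symm

/-- A function that is nonvanishing on `U` has a winding number along the core curves. -/
theorem exists_winding (hΦ : IsAnnularChart Φ U) {h : ℂ → ℂ} (hc : ContinuousOn h U)
    (h0 : ∀ z ∈ U, h z ≠ 0) : ∃ n : ℤ, ∀ s, HasWinding (fun y => h (Φ (s, y))) n := by
  obtain ⟨-, n, -, -, -, hn⟩ := exists_winding_lift (g := fun p => h (Φ p))
    (hc.comp_continuous hΦ.continuous hΦ.mem) (fun p => h0 _ (hΦ.mem p))
    (fun s y => by rw [hΦ.periodic])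
  exact ⟨n, hn⟩

/-- With winding number zero, the logarithm lifted to the plane is itself `2π`-periodic, so it
descends to `U`. -/
theorem exists_log (hΦ : IsAnnularChart Φ U) {h : ℂ → ℂ} (hc : ContinuousOn h U)
    (h0 : ∀ z ∈ U, h z ≠ 0) {s : ℝ} (hs : HasWinding (fun y => h (Φ (s, y))) 0) :
    ∃ L : ℂ → ℂ, ContinuousOn L U ∧ ∀ z ∈ U, Complex.exp (L z) = h z := by
  obtain ⟨G, n, hG, hGe, hGp, hn⟩ := exists_winding_lift (g := fun p => h (Φ p))
    (hc.comp_continuous hΦ.continuous hΦ.mem) (fun p => h0 _ (hΦ.mem p))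
    (fun s y => by rw [hΦ.periodic])
  obtain rfl := (hn s).unique hs
  have hGz : ∀ s y (k : ℤ), G (s, y + k * (2 * Real.pi)) = G (s, y) := by
    intro s y k
    have : Function.Periodic (fun y => G (s, y)) (2 * Real.pi) := fun y => by simp [hGp]
    exact this.int_mul k y
  have hfac : ∀ p q, Φ p = Φ q → G p = G q := by
    intro p q hpq
    obtain ⟨k, rfl⟩ := (hΦ.eq_iff p q).1 hpq
    exact (hGz p.1 p.2 k).symm
  have hsurj : ∀ z ∈ U, ∃ p, Φ p = z := fun z hz => by rwa [← hΦ.range_eq] at hz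
  choose! σ hσ using hsurj
  have hLΦ : ∀ p, G (σ (Φ p)) = G p := fun p => hfac _ _ (hσ _ (hΦ.mem p))
  refine ⟨fun z => G (σ z), fun z hz => ContinuousAt.continuousWithinAt ?_, fun z hz => ?_⟩
  · obtain ⟨p, rfl⟩ : ∃ p, Φ p = z := ⟨σ z, hσ z hz⟩
    rw [ContinuousAt, hLΦ]
    -- The section `σ` need not be continuous; continuity downstairs comes from `Φ` being open.
    have : Filter.Tendsto (fun z => G (σ z)) (Filter.map Φ (nhds p)) (nhds (G p)) := by
      rw [Filter.tendsto_map'_iff]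
      have : (fun z => G (σ z)) ∘ Φ = G := funext hLΦ
      rw [this]
      exact hG.continuousAt
    exact this.mono_left (hΦ.isOpenMap.nhds_le p)
  · simp only [hGe, hσ z hz]

end IsAnnularChart

/-- The sigmoid squeezes the line onto (0, 1), so that charts of annuli can be defined on the whole,
simply connected, plane. -/
theorem isOpenMap_sigmoid : IsOpenMap Real.sigmoid :=
  isOpenMap_of_hasStrictDerivAt (f' := fun x => Real.sigmoid x * (1 - Real.sigmoid x))
    (fun x => by
      have h := (contDiff_sigmoid.contDiffAt (x := x)).hasStrictDerivAt (by simp)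
      rwa [Real.deriv_sigmoid] at h)
    (fun x => (mul_pos (Real.sigmoid_pos x) (sub_pos.2 (Real.sigmoid_lt_one x))).ne')

theorem isOpen_roundAnnulus (r R : ℝ) : IsOpen (roundAnnulus r R) :=
  (isOpen_lt continuous_const continuous_norm).inter (isOpen_lt continuous_norm continuous_const)

/-- The standard chart of the round annulus of inner radius `1` and modulus `m`. -/
noncomputable def roundChart (m : ℝ) (p : ℝ × ℝ) : ℂ :=
  Complex.exp ((m * Real.sigmoid p.1 : ℝ) + p.2 * Complex.I)

theorem exp_mem_roundAnnulus_one_exp {m : ℝ} {w : ℂ} :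
    Complex.exp w ∈ roundAnnulus 1 (Real.exp m) ↔ 0 < w.re ∧ w.re < m := by
  simp [roundAnnulus, Complex.norm_exp]

theorem exists_mul_sigmoid {m t : ℝ} (h0 : 0 < t) (hm : t < m) : ∃ s, m * Real.sigmoid s = t := by
  have hm0 := h0.trans hm
  have : t / m ∈ Set.range Real.sigmoid := by
    rw [Real.range_sigmoid]
    exact ⟨div_pos h0 hm0, (div_lt_one hm0).2 hm⟩
  obtain ⟨s, hs⟩ := this
  exact ⟨s, by rw [hs]; field_simp⟩

theorem isAnnularChart_roundChart {m : ℝ} (hm : 0 < m) :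
    IsAnnularChart (roundChart m) (roundAnnulus 1 (Real.exp m)) := by
  refine ⟨?_, ?_, ?_, ?_⟩
  · unfold roundChart
    have := continuous_sigmoid
    fun_prop
  · have h1 : IsOpenMap (fun x => m * Real.sigmoid x) :=
      (Homeomorph.mulLeft₀ m hm.ne').isOpenMap.comp isOpenMap_sigmoid
    have h2 := Complex.isOpenMap_exp.comp
      (Complex.equivRealProdCLM.symm.toHomeomorph.isOpenMap.comp (h1.prodMap IsOpenMap.id))
    convert h2 using 1
    ext p
    simp [roundChart, Complex.equivRealProdCLM_symm_apply]
  · ext z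
    constructor
    · rintro ⟨p, rfl⟩
      refine exp_mem_roundAnnulus_one_exp.2 ?_
      have h1 := mul_lt_mul_of_pos_left (Real.sigmoid_lt_one p.1) hm
      have h2 := mul_pos hm (Real.sigmoid_pos p.1)
      simpa using And.intro h2 h1
    · intro hz
      have hz0 : z ≠ 0 := by
        rintro rfl
        have := hz.1
        simp at this
        linarith
      rw [← Complex.exp_log hz0, exp_mem_roundAnnulus_one_exp] at hz
      obtain ⟨s, hs⟩ := exists_mul_sigmoid hz.1 hz.2
      refine ⟨(s, (Complex.log z).im), ?_⟩
      rw [roundChart, hs, Complex.re_add_im, Complex.exp_log hz0]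
  · rintro ⟨s, y⟩ ⟨s', y'⟩
    simp only [roundChart, Complex.exp_eq_exp_iff_exists_int, Prod.mk.injEq]
    constructor
    · rintro ⟨n, hn⟩
      have hre := congrArg Complex.re hn
      have him := congrArg Complex.im hn
      simp at hre him
      refine ⟨-n, ?_, ?_⟩
      · rcases hre with h | h
        · exact h.symm
        · exact absurd h hm.ne'
      · push_cast; linarith
    · rintro ⟨n, rfl, rfl⟩
      exact ⟨-n, by push_cast; ring⟩

theorem IsAnnularChart.comp {Φ : ℝ × ℝ → ℂ} {U V : Set ℂ} (hΦ : IsAnnularChart Φ U)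
    {f : ℂ → ℂ} (hc : ContinuousOn f U) (hf : Set.BijOn f U V)
    (ho : ∀ s ⊆ U, IsOpen s → IsOpen (f '' s)) : IsAnnularChart (f ∘ Φ) V := by
  refine ⟨hc.comp_continuous hΦ.continuous hΦ.mem, fun s hs => ?_, ?_, fun p q => ?_⟩
  · rw [Set.image_comp]
    refine ho _ ?_ (hΦ.isOpenMap s hs)
    rintro _ ⟨p, -, rfl⟩
    exact hΦ.mem p
  · rw [Set.range_comp, hΦ.range_eq, hf.image_eq]
  · rw [← hΦ.eq_iff]
    exact hf.injOn.eq_iff (hΦ.mem p) (hΦ.mem q)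

/-- Openness of the chart is the open mapping theorem; injectivity rules out constant `f`. -/
theorem isAnnularChart_of_conformal {m : ℝ} (hm : 0 < m) {f : ℂ → ℂ} {U : Set ℂ}
    (hd : DifferentiableOn ℂ f (roundAnnulus 1 (Real.exp m)))
    (hf : Set.BijOn f (roundAnnulus 1 (Real.exp m)) U) :
    IsAnnularChart (f ∘ roundChart m) U := by
  have hΦ := isAnnularChart_roundChart hm
  refine hΦ.comp hd.continuousOn hf ?_
  have hpre : IsPreconnected (roundAnnulus 1 (Real.exp m)) := by
    rw [← hΦ.range_eq]
    exact isPreconnected_range hΦ.continuous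
  refine ((hd.analyticOnNhd (isOpen_roundAnnulus _ _)).is_constant_or_isOpen hpre).resolve_left ?_
  rintro ⟨w, hw⟩
  -- The angles 0 and 1 give distinct points, since 1 is not a multiple of 2π.
  have h := hf.injOn (hΦ.mem (0, 0)) (hΦ.mem (0, 1)) (by
    rw [hw _ (hΦ.mem (0, 0)), hw _ (hΦ.mem (0, 1))])
  obtain ⟨n, hn⟩ := (hΦ.eq_iff _ _).1 h
  have h1 : (n : ℝ) * (2 * Real.pi) = 1 := by simpa using (congrArg Prod.snd hn).symm
  have hpi := Real.pi_gt_three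
  have hn0 : (0 : ℝ) < n := by
    by_contra hcon
    nlinarith
  have : (1 : ℝ) ≤ n := by exact_mod_cast (by exact_mod_cast hn0 : (0 : ℤ) < n)
  nlinarith

theorem IsTopologicalAnnulus.exists_chart {U : Set ℂ} (hU : IsTopologicalAnnulus U) :
    ∃ Φ, IsAnnularChart Φ U := by
  obtain ⟨hUo, ⟨e⟩⟩ := hU
  have hΦ := isAnnularChart_roundChart (Real.log_pos one_lt_two)
  rw [Real.exp_log two_pos] at hΦ
  classical
  set f : ℂ → ℂ := fun z => if h : z ∈ roundAnnulus 1 2 then e.symm ⟨z, h⟩ else 0 with hfdef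
  have hf : ∀ z : roundAnnulus 1 2, f z = e.symm z := fun z => by simp [hfdef]
  refine ⟨_, hΦ.comp (f := f) (V := U) ?_ ⟨?_, ?_, ?_⟩ ?_⟩
  · rw [continuousOn_iff_continuous_domRestrict]
    have : (roundAnnulus 1 2).domRestrict f = fun z => (e.symm z : ℂ) := funext hf
    rw [this]
    fun_prop
  · intro z hz
    rw [hf ⟨z, hz⟩]
    exact (e.symm _).2
  · intro z hz w hw h
    rw [hf ⟨z, hz⟩, hf ⟨w, hw⟩] at h
    simpa using e.symm.injective (Subtype.ext h)
  · intro u hu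
    refine ⟨e ⟨u, hu⟩, (e _).2, ?_⟩
    rw [hf]
    simp
  · intro s hs hso
    have : f '' s = Subtype.val '' (e.symm '' (Subtype.val ⁻¹' s)) := by
      ext z
      constructor
      · rintro ⟨w, hw, rfl⟩
        exact ⟨_, ⟨⟨w, hs hw⟩, hw, rfl⟩, (hf ⟨w, hs hw⟩).symm⟩
      · rintro ⟨_, ⟨w, hw, rfl⟩, rfl⟩
        exact ⟨w, hw, hf w⟩
    rw [this]
    exact hUo.isOpenMap_subtype_val _ (e.symm.isOpenMap _ (hso.preimage continuous_subtype_val))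

/-! ### Winding numbers around points off the curve. -/

namespace HasWinding

variable {γ : ℝ → ℂ} {n : ℤ} {k : ℂ}

theorem sub_of_norm_lt (h : HasWinding γ n) (hk : ∀ y, ‖k‖ < ‖γ y‖) :
    HasWinding (fun y => γ y - k) n :=
  h.of_near (by have := h.continuous; fun_prop) (fun y => by rw [h.periodic])
    (fun y => by simpa using hk y)

theorem sub_of_lt_norm (hc : Continuous γ) (hp : ∀ y, γ (y + 2 * Real.pi) = γ y)
    (hk : ∀ y, ‖γ y‖ < ‖k‖) : HasWinding (fun y => γ y - k) 0 := by
  have hk0 : -k ≠ 0 := by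
    rw [neg_ne_zero, ← norm_pos_iff]
    exact (norm_nonneg _).trans_lt (hk 0)
  exact (HasWinding.const hk0).of_near (by fun_prop) (fun y => by rw [hp])
    (fun y => by simpa using hk y)

/-- The winding number is constant on connected sets that the curve avoids. -/
theorem sub_of_isPreconnected (hc : Continuous γ) (hp : ∀ y, γ (y + 2 * Real.pi) = γ y)
    {C : Set ℂ} (hC : IsPreconnected C) (hγ : ∀ y, γ y ∉ C) {p : ℂ} (hk : k ∈ C) (hpC : p ∈ C)
    (h : HasWinding (fun y => γ y - k) n) : HasWinding (fun y => γ y - p) n := by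
  have hK : IsClosed (Set.range γ) := by
    have : Function.Periodic γ (2 * Real.pi) := hp
    rw [← this.image_Icc (by positivity) 0]
    exact (isCompact_Icc.image hc).isClosed
  -- Having the same winding numbers is an equivalence relation that holds locally, because the
  -- curve has compact image and so stays at positive distance from each point of `C`.
  refine (hC.induction₂ (fun z z' => ∀ n, HasWinding (fun y => γ y - z) n ↔
    HasWinding (fun y => γ y - z') n) ?_ ?_ ?_ hk hpC n).1 h
  · intro z hz
    have hzK : z ∉ Set.range γ := by rintro ⟨y, rfl⟩; exact hγ y hz
    obtain ⟨δ, hδ, hδK⟩ := Metric.isOpen_iff.1 hK.isOpen_compl z hzK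
    have hfar : ∀ y, δ ≤ ‖γ y - z‖ := by
      intro y
      by_contra hcon
      exact hδK (mem_ball_iff_norm.2 (not_le.1 hcon)) ⟨y, rfl⟩
    filter_upwards [mem_nhdsWithin_of_mem_nhds (Metric.ball_mem_nhds z (half_pos hδ))] with z' hz'
    rw [mem_ball_iff_norm] at hz'
    intro n
    have hfar' : ∀ y, δ / 2 ≤ ‖γ y - z'‖ := by
      intro y
      have h1 := norm_add_le (γ y - z') (z' - z)
      rw [sub_add_sub_cancel] at h1
      linarith [hfar y]
    constructor
    · intro h
      refine h.of_near (by fun_prop) (fun y => by rw [hp]) (fun y => ?_)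
      rw [sub_sub_sub_cancel_left, norm_sub_rev]
      linarith [hfar y]
    · intro h
      refine h.of_near (by fun_prop) (fun y => by rw [hp]) (fun y => ?_)
      rw [sub_sub_sub_cancel_left]
      linarith [hfar' y]
  · intro x y z _ _ _ h1 h2 n
    exact (h1 n).trans (h2 n)
  · intro x y _ _ h n
    exact (h n).symm

theorem circle (s : ℝ) : HasWinding (fun y => Complex.exp ((s : ℂ) + y * Complex.I)) 1 :=
  ⟨fun y => (s : ℂ) + y * Complex.I, by fun_prop, fun _ => rfl, fun y => by push_cast; ring⟩

end HasWinding

/-! ### Separation from the boundary as an obstruction to logarithms. -/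

theorem isCompact_closure_roundAnnulus (r R : ℝ) : IsCompact (closure (roundAnnulus r R)) := by
  refine (Metric.isBounded_ball (x := (0 : ℂ)) (r := R)).subset ?_ |>.isCompact_closure
  intro z hz
  simpa using hz.2

/-- A point separated by `S` from the boundary of `A` has a neighbourhood of the form
`S ∪ P` with `P` closed. -/
theorem exists_isClosed_of_mem_separatedPart {A S : Set ℂ} (hA : IsOpen A)
    (hAc : IsCompact (closure A)) (hS : IsOpen S) (hSA : S ⊆ A) {k : ℂ}
    (hk : k ∈ separatedPart A S) :
    ∃ P : Set ℂ, IsClosed P ∧ k ∈ P ∧ P ⊆ A ∧ Disjoint P S ∧ IsOpen (S ∪ P) := by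
  obtain ⟨⟨hkA, hkS⟩, hdis⟩ := hk
  have hX : IsCompact (closure A \ S) := hAc.diff hS
  have hkX : k ∈ closure A \ S := ⟨subset_closure hkA, hkS⟩
  have : CompactSpace ↥(closure A \ S) := isCompact_iff_compactSpace.1 hX
  -- In a compact Hausdorff space a component is the intersection of the clopen sets containing it;
  -- by compactness one of these already misses the frontier.
  rw [connectedComponentIn_eq_image hkX, connectedComponent_eq_iInter_isClopen] at hdis
  set x : ↥(closure A \ S) := ⟨k, hkX⟩
  have : Nonempty {s : Set ↥(closure A \ S) // IsClopen s ∧ x ∈ s} :=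
    ⟨⟨Set.univ, isClopen_univ, Set.mem_univ _⟩⟩
  have hopen : IsOpen ((Subtype.val : ↥(closure A \ S) → ℂ) ⁻¹' (frontier A)ᶜ) :=
    isClosed_frontier.isOpen_compl.preimage continuous_subtype_val
  obtain ⟨⟨C, hC, hxC⟩, hCsub⟩ := exists_subset_nhds_of_isCompact
    (V := fun s : {s : Set ↥(closure A \ S) // IsClopen s ∧ x ∈ s} => (s : Set _))
    (U := Subtype.val ⁻¹' (frontier A)ᶜ)
    (fun s t => ⟨⟨s ∩ t, s.2.1.inter t.2.1, s.2.2, t.2.2⟩, Set.inter_subset_left,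
      Set.inter_subset_right⟩)
    (fun s => s.2.1.1.isCompact)
    (fun y hy => hopen.mem_nhds fun hyf =>
      Set.disjoint_left.1 hdis (Set.mem_image_of_mem _ hy) hyf)
  have hP : IsClosed (Subtype.val '' C : Set ℂ) :=
    (hC.1.isCompact.image continuous_subtype_val).isClosed
  have hY : IsClosed (Subtype.val '' Cᶜ : Set ℂ) :=
    (hC.compl.1.isCompact.image continuous_subtype_val).isClosed
  have hPA : (Subtype.val '' C : Set ℂ) ⊆ A := by
    rintro _ ⟨y, hy, rfl⟩
    by_contra hyA
    exact hCsub hy ⟨y.2.1, by rwa [hA.interior_eq]⟩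
  refine ⟨Subtype.val '' C, hP, ⟨x, hxC, rfl⟩, hPA, ?_, ?_⟩
  · rw [Set.disjoint_left]
    rintro _ ⟨y, -, rfl⟩ hyS
    exact y.2.2 hyS
  · have : S ∪ Subtype.val '' C = A \ Subtype.val '' Cᶜ := by
      ext z
      constructor
      · rintro (hz | ⟨y, hy, rfl⟩)
        · refine ⟨hSA hz, ?_⟩
          rintro ⟨y, -, rfl⟩
          exact y.2.2 hz
        · refine ⟨hPA ⟨y, hy, rfl⟩, ?_⟩
          rintro ⟨y', hy', he⟩
          exact hy' (Subtype.ext he ▸ hy)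
      · rintro ⟨hzA, hz⟩
        by_cases hzS : z ∈ S
        · exact Or.inl hzS
        · right
          refine ⟨⟨z, subset_closure hzA, hzS⟩, ?_, rfl⟩
          by_contra hcon
          exact hz ⟨_, hcon, rfl⟩
    rw [this]
    exact hA.sdiff hY

/-- Let `P` be closed and `S`, `S ∪ P` open. A function that has a continuous logarithm on `S` can
be changed inside `S ∪ P` so as to have no zero there. -/
theorem exists_continuousAt_extension {S P : Set ℂ} (hS : IsOpen S) (hP : IsClosed P)
    (hPS : Disjoint P S) (hSP : IsOpen (S ∪ P)) {h L : ℂ → ℂ} (hL : ContinuousOn L S)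
    (hLe : ∀ z ∈ S, Complex.exp (L z) = h z) :
    ∃ g : ℂ → ℂ, (∀ z ∈ S ∪ P, ContinuousAt g z ∧ g z ≠ 0) ∧ (∀ z ∉ S ∪ P, g z = h z) ∧
      ∀ z ∉ S ∪ P, ContinuousAt h z → ContinuousAt g z := by
  classical
  obtain ⟨χ, hχ0, hχ1, -⟩ := exists_continuous_zero_one_of_isClosed hP hSP.isClosed_compl
    (Set.disjoint_compl_right_iff_subset.2 Set.subset_union_right)
  -- This cutoff is 0 on a neighbourhood of `P` and 1 on a neighbourhood of the complement of `S ∪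
  -- P`. Thus `exp (ψ L)` glues continuously to 1 on `P`, and to `h` wherever `h` is continuous
  -- outside, although `L` is uncontrolled near the boundary of `S`.
  set ψ : ℂ → ℝ := fun z => max 0 (min 1 (3 * χ z - 1)) with hψ
  have hψc : Continuous ψ := by fun_prop
  have hψ0 : ∀ z, χ z < 1 / 3 → ψ z = 0 := fun z hz =>
    max_eq_left ((min_le_right _ _).trans (by linarith))
  have hψ1 : ∀ z, 2 / 3 < χ z → ψ z = 1 := fun z hz => by
    simp only [hψ]
    rw [min_eq_left (by linarith), max_eq_right zero_le_one]
  set g : ℂ → ℂ := fun z =>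
    if z ∈ S then Complex.exp (ψ z * L z) else if z ∈ P then 1 else h z with hg
  have hgS : ∀ z ∈ S, g z = Complex.exp (ψ z * L z) := fun z hz => by simp [hg, hz]
  have hgP : ∀ z ∈ P, g z = 1 := fun z hz => by simp [hg, hz, Set.disjoint_left.1 hPS hz]
  have hgh : ∀ z ∉ S ∪ P, g z = h z := fun z hz => by
    rw [Set.mem_union, not_or] at hz
    simp [hg, hz.1, hz.2]
  refine ⟨g, ?_, hgh, ?_⟩
  · rintro z (hz | hz)
    · refine ⟨?_, by rw [hgS z hz]; exact Complex.exp_ne_zero _⟩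
      have hLz := hL.continuousAt (hS.mem_nhds hz)
      have : ContinuousAt (fun z => Complex.exp (ψ z * L z)) z := by
        have := hψc.continuousAt (x := z)
        fun_prop
      exact this.congr (Filter.eventually_of_mem (hS.mem_nhds hz) fun w hw => (hgS w hw).symm)
    · refine ⟨?_, by rw [hgP z hz]; exact one_ne_zero⟩
      have h1 : {w | χ w < 1 / 3} ∈ nhds z :=
        (isOpen_lt χ.continuous continuous_const).mem_nhds (by simp [hχ0 hz])
      refine (continuousAt_const (y := (1 : ℂ))).congr ?_
      filter_upwards [h1, hSP.mem_nhds (Or.inr hz)] with w hw1 hw2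
      rcases hw2 with hw2 | hw2
      · simp [hgS w hw2, hψ0 w hw1]
      · exact (hgP w hw2).symm
  · intro z hz hhz
    have h1 : {w | 2 / 3 < χ w} ∈ nhds z :=
      (isOpen_lt continuous_const χ.continuous).mem_nhds (by
        have := hχ1 hz
        simp only [Pi.one_apply] at this
        simp only [Set.mem_ofPred_eq, this]; norm_num)
    refine hhz.congr ?_
    filter_upwards [h1] with w hw
    by_cases hwS : w ∈ S
    · simp [hgS w hwS, hψ1 w hw, hLe w hwS]
    · refine (hgh w ?_).symm
      rintro (h | h)
      · exact hwS h
      · have := hχ0 h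
        simp only [Pi.zero_apply] at this
        simp only [this] at hw
        norm_num at hw

theorem continuousAt_sub_zpow_mul {k k' z : ℂ} {a a' b : ℤ} (hk : z ≠ k) (hk' : z ≠ k')
    (h0 : z ≠ 0) : ContinuousAt (fun z => (z - k) ^ a * (z - k') ^ a' * z ^ b) z :=
  (((continuousAt_id.sub continuousAt_const).zpow₀ _ (Or.inl (sub_ne_zero.2 hk))).mul
    ((continuousAt_id.sub continuousAt_const).zpow₀ _ (Or.inl (sub_ne_zero.2 hk')))).mul
    (continuousAt_id.zpow₀ _ (Or.inl h0))

/-- If `S` separates `k` and `k'` from the boundary of a round annulus, then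
`(z - k) ^ a * (z - k') ^ a' * z ^ b` with `a + a' ≠ 0` has no continuous logarithm on `S`. -/
theorem not_exists_log_of_mem_separatedPart {r R : ℝ} (hr : 0 < r) {S : Set ℂ} (hS : IsOpen S)
    (hSA : S ⊆ roundAnnulus r R) {k k' : ℂ} (hk : k ∈ separatedPart (roundAnnulus r R) S)
    (hk' : k' ∈ separatedPart (roundAnnulus r R) S) {a a' b : ℤ} (ha : a + a' ≠ 0) :
    ¬ ∃ L : ℂ → ℂ, ContinuousOn L S ∧
      ∀ z ∈ S, Complex.exp (L z) = (z - k) ^ a * (z - k') ^ a' * z ^ b := by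
  rintro ⟨L, hL, hLe⟩
  have hA := isOpen_roundAnnulus r R
  have hAc := isCompact_closure_roundAnnulus r R
  obtain ⟨P₁, hP₁, hkP, hPA₁, hPS₁, hSP₁⟩ := exists_isClosed_of_mem_separatedPart hA hAc hS hSA hk
  obtain ⟨P₂, hP₂, hkP', hPA₂, hPS₂, hSP₂⟩ :=
    exists_isClosed_of_mem_separatedPart hA hAc hS hSA hk'
  have hSP : IsOpen (S ∪ (P₁ ∪ P₂)) := by
    rw [Set.union_union_distrib_left]
    exact hSP₁.union hSP₂
  obtain ⟨g, hg1, hg2, hg3⟩ := exists_continuousAt_extension hS (hP₁.union hP₂)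
    (hPS₁.union_left hPS₂) hSP hL hLe
  have hsub : S ∪ (P₁ ∪ P₂) ⊆ roundAnnulus r R :=
    Set.union_subset hSA (Set.union_subset hPA₁ hPA₂)
  have hne : ∀ z ∉ S ∪ (P₁ ∪ P₂), z ≠ k ∧ z ≠ k' := by
    intro z hz
    constructor
    · rintro rfl; exact hz (Or.inr (Or.inl hkP))
    · rintro rfl; exact hz (Or.inr (Or.inr hkP'))
  -- The zeros or poles at `k` and `k'` lie in the altered region, so 0 is the only singularity
  -- left.
  have hgc : ∀ z ≠ 0, ContinuousAt g z := by
    intro z hz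
    by_cases hzW : z ∈ S ∪ (P₁ ∪ P₂)
    · exact (hg1 z hzW).1
    · exact hg3 z hzW (continuousAt_sub_zpow_mul (hne z hzW).1 (hne z hzW).2 hz)
  have hg0 : ∀ z ≠ 0, g z ≠ 0 := by
    intro z hz
    by_cases hzW : z ∈ S ∪ (P₁ ∪ P₂)
    · exact (hg1 z hzW).2
    · rw [hg2 z hzW]
      exact mul_ne_zero (mul_ne_zero (zpow_ne_zero _ (sub_ne_zero.2 (hne z hzW).1))
        (zpow_ne_zero _ (sub_ne_zero.2 (hne z hzW).2))) (zpow_ne_zero _ hz)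
  obtain ⟨-, n, -, -, -, hn⟩ := exists_winding_lift
    (g := fun p : ℝ × ℝ => g (Complex.exp ((p.1 : ℂ) + p.2 * Complex.I)))
    (continuous_iff_continuousAt.2 fun p => ContinuousAt.comp (g := g)
      (f := fun p : ℝ × ℝ => Complex.exp ((p.1 : ℂ) + p.2 * Complex.I))
      (hgc _ (Complex.exp_ne_zero _)) (by fun_prop))
    (fun p => hg0 _ (Complex.exp_ne_zero _))
    (fun s y => by
      rw [(HasWinding.circle s).periodic y])
  have hcn : ∀ s y : ℝ, ‖Complex.exp ((s : ℂ) + y * Complex.I)‖ = Real.exp s := by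
    intro s y; simp [Complex.norm_exp]
  have hout : ∀ s : ℝ, (Real.exp s ≤ r ∨ R ≤ Real.exp s) → ∀ y : ℝ,
      g (Complex.exp ((s : ℂ) + y * Complex.I)) = (Complex.exp ((s : ℂ) + y * Complex.I) - k) ^ a *
        (Complex.exp ((s : ℂ) + y * Complex.I) - k') ^ a' *
        Complex.exp ((s : ℂ) + y * Complex.I) ^ b := by
    intro s hs y
    apply hg2
    intro hmem
    have := hsub hmem
    rw [roundAnnulus, Set.mem_ofPred_eq, hcn] at this
    rcases hs with hs | hs <;> linarith [this.1, this.2]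
  have hkA := hk.1.1
  have hkA' := hk'.1.1
  have hR : 0 < R := hr.trans (hkA.1.trans hkA.2)
  -- On the inner circle only `z ^ b` winds, as `k` and `k'` are outside it; on the outer circle all
  -- three factors do.
  have hin : n = a * 0 + a' * 0 + b * 1 := by
    refine (hn (Real.log r)).unique ?_
    rw [funext (hout (Real.log r) (Or.inl (Real.exp_log hr).le))]
    have hc := HasWinding.circle (Real.log r)
    refine ((HasWinding.sub_of_lt_norm hc.continuous hc.periodic fun y => ?_).zpow a).mul
      ((HasWinding.sub_of_lt_norm hc.continuous hc.periodic fun y => ?_).zpow a') |>.mul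
      (hc.zpow b)
    · rw [hcn, Real.exp_log hr]; exact hkA.1
    · rw [hcn, Real.exp_log hr]; exact hkA'.1
  have hextr : n = a * 1 + a' * 1 + b * 1 := by
    refine (hn (Real.log R)).unique ?_
    rw [funext (hout (Real.log R) (Or.inr (Real.exp_log hR).ge))]
    have hc := HasWinding.circle (Real.log R)
    refine ((hc.sub_of_norm_lt fun y => ?_).zpow a).mul
      ((hc.sub_of_norm_lt fun y => ?_).zpow a') |>.mul (hc.zpow b)
    · rw [hcn, Real.exp_log hR]; exact hkA.2
    · rw [hcn, Real.exp_log hR]; exact hkA'.2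
  exact ha (by linarith)

theorem zero_notMem_roundAnnulus {r R : ℝ} (hr : 0 < r) : (0 : ℂ) ∉ roundAnnulus r R := by
  intro h
  have := h.1
  rw [norm_zero] at this
  exact this.not_gt hr

/-! ### Core curves of essential annuli. -/

namespace IsAnnularChart

variable {Φ : ℝ × ℝ → ℂ} {U : Set ℂ} {r R : ℝ}

theorem continuous_curve (hΦ : IsAnnularChart Φ U) (s : ℝ) : Continuous fun y => Φ (s, y) :=
  hΦ.continuous.comp (by fun_prop)

theorem exists_winding_sub (hΦ : IsAnnularChart Φ U) {k : ℂ} (hk : k ∉ U) :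
    ∃ n : ℤ, ∀ s, HasWinding (fun y => Φ (s, y) - k) n :=
  hΦ.exists_winding (h := fun z => z - k) (by fun_prop)
    (fun z hz h0 => hk (by rwa [← sub_eq_zero.1 h0]))

/-- The core curves of an essential annulus wind around the origin. -/
theorem exists_winding_ne_zero (hr : 0 < r) (hΦ : IsAnnularChart Φ U)
    (hU : IsHomotopicallyNontrivialIn U (roundAnnulus r R)) :
    ∃ n : ℤ, n ≠ 0 ∧ ∀ s, HasWinding (fun y => Φ (s, y)) n := by
  obtain ⟨hUA, hess⟩ := hU
  have hU0 : ∀ z ∈ U, z ≠ 0 := fun z hz h0 => zero_notMem_roundAnnulus hr (h0 ▸ hUA hz)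
  obtain ⟨n, hn⟩ := hΦ.exists_winding (h := fun z => z) (by fun_prop) hU0
  refine ⟨n, ?_, hn⟩
  rintro rfl
  obtain ⟨L, hL, hLe⟩ := hΦ.exists_log (h := fun z => z) (by fun_prop) hU0 (hn 0)
  apply hess
  have hre : ∀ z ∈ U, Real.log r < (L z).re ∧ (L z).re < Real.log R := by
    intro z hz
    have hzA := hUA hz
    have hnorm : ‖z‖ = Real.exp (L z).re := by rw [← Complex.norm_exp, hLe z hz]
    rw [roundAnnulus, Set.mem_ofPred_eq, hnorm] at hzA
    have hR : 0 < R := (Real.exp_pos _).trans hzA.2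
    exact ⟨(Real.log_lt_iff_lt_exp hr).2 hzA.1, (Real.lt_log_iff_exp_lt hR).2 hzA.2⟩
  set z₀ : U := ⟨Φ (0, 0), hΦ.mem _⟩
  have hR : 0 < R := hr.trans ((hUA z₀.2).1.trans (hUA z₀.2).2)
  have hLU : Continuous fun z : U => L z := hL.comp_continuous continuous_subtype_val fun z => z.2
  -- A logarithm on `U` would take values in the convex strip log r < Re < log R; the straight-line
  -- contraction there exponentiates to a nullhomotopy in the annulus.
  refine ⟨⟨z₀, hUA z₀.2⟩, ⟨⟨⟨fun p => ⟨Complex.exp ((1 - (p.1 : ℝ)) * L p.2 + (p.1 : ℝ) * L z₀), ?_⟩,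
    ?_⟩, ?_, ?_⟩⟩⟩
  · have h1 := p.1.2.1
    have h2 := p.1.2.2
    have hconv := (convex_Ioo (Real.log r) (Real.log R)) (hre p.2 p.2.2) (hre z₀ z₀.2)
      (sub_nonneg.2 h2) h1 (by ring)
    rw [roundAnnulus, Set.mem_ofPred_eq, Complex.norm_exp]
    rw [Set.mem_Ioo, Real.log_lt_iff_lt_exp hr, Real.lt_log_iff_exp_lt hR] at hconv
    simpa using hconv
  · refine Continuous.subtype_mk ?_ _
    have hL2 : Continuous fun p : unitInterval × U => L p.2 := hLU.comp continuous_snd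
    have ht : Continuous fun p : unitInterval × U => ((p.1 : ℝ) : ℂ) :=
      Complex.continuous_ofReal.comp (continuous_subtype_val.comp continuous_fst)
    exact Complex.continuous_exp.comp
      (((continuous_const.sub ht).mul hL2).add (ht.mul continuous_const))
  · intro z
    simp [ContinuousMap.inclusion, hLe z z.2]
  · intro z
    simp [hLe z₀ z₀.2]

/-- A product of powers whose winding number vanishes has a continuous logarithm. -/
theorem exists_log_of_winding (hr : 0 < r) (hΦ : IsAnnularChart Φ U)
    (hUA : U ⊆ roundAnnulus r R) {k k' : ℂ} (hk : k ∉ U) (hk' : k' ∉ U) {n m m' a a' b : ℤ} {s : ℝ}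
    (hn : HasWinding (fun y => Φ (s, y)) n) (hm : HasWinding (fun y => Φ (s, y) - k) m)
    (hm' : HasWinding (fun y => Φ (s, y) - k') m') (h0 : a * m + a' * m' + b * n = 0) :
    ∃ L : ℂ → ℂ, ContinuousOn L U ∧
      ∀ z ∈ U, Complex.exp (L z) = (z - k) ^ a * (z - k') ^ a' * z ^ b := by
  have hne : ∀ z ∈ U, z ≠ k ∧ z ≠ k' ∧ z ≠ 0 := fun z hz =>
    ⟨fun h => hk (h ▸ hz), fun h => hk' (h ▸ hz),
      fun h => zero_notMem_roundAnnulus hr (h ▸ hUA hz)⟩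
  refine hΦ.exists_log (h := fun z => (z - k) ^ a * (z - k') ^ a' * z ^ b) (fun z hz => ?_)
    (fun z hz => ?_) (h0 ▸ ((hm.zpow a).mul (hm'.zpow a')).mul (hn.zpow b))
  · obtain ⟨h1, h2, h3⟩ := hne z hz
    exact (continuousAt_sub_zpow_mul h1 h2 h3).continuousWithinAt
  · obtain ⟨h1, h2, h3⟩ := hne z hz
    exact mul_ne_zero (mul_ne_zero (zpow_ne_zero _ (sub_ne_zero.2 h1))
      (zpow_ne_zero _ (sub_ne_zero.2 h2))) (zpow_ne_zero _ h3)

/-- A core curve winds around a point of the complement as it winds around the origin,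
or not at all. -/
theorem winding_eq_zero_or_eq (hr : 0 < r) (hΦ : IsAnnularChart Φ U)
    (hUA : U ⊆ roundAnnulus r R) {n : ℤ} (hn0 : n ≠ 0) {s : ℝ}
    (hn : HasWinding (fun y => Φ (s, y)) n) {k : ℂ} (hkA : k ∈ roundAnnulus r R) (hk : k ∉ U)
    {m : ℤ} (hm : HasWinding (fun y => Φ (s, y) - k) m) : m = 0 ∨ m = n := by
  by_cases hsep : k ∈ separatedPart (roundAnnulus r R) U
  -- If `U` alone separates `k`, then (z - k)^n z^(-m) has total winding nm - mn = 0, against the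
  -- obstruction with exponent sum n ≠ 0.
  · exact absurd (hΦ.exists_log_of_winding hr hUA hk hk hn hm hm
      (a := n) (a' := 0) (b := -m) (by ring))
      (not_exists_log_of_mem_separatedPart hr hΦ.isOpen hUA hsep hsep (by simpa using hn0))
  · have hkX : k ∈ closure (roundAnnulus r R) \ U := ⟨subset_closure hkA, hk⟩
    have hnd : ¬ Disjoint (connectedComponentIn (closure (roundAnnulus r R) \ U) k)
        (frontier (roundAnnulus r R)) := fun hd => hsep ⟨⟨hkA, hk⟩, hd⟩
    -- Otherwise `k` can be moved off the curve to the boundary: the inner circle gives winding `n`,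
    -- the outer one 0.
    obtain ⟨p, hpC, hpf⟩ := Set.not_disjoint_iff.1 hnd
    have hp := hm.sub_of_isPreconnected (hΦ.continuous_curve s) hn.periodic
      isPreconnected_connectedComponentIn
      (fun y hy => (connectedComponentIn_subset _ _ hy).2 (hΦ.mem _))
      (mem_connectedComponentIn hkX) hpC
    have hpA : ¬ (r < ‖p‖ ∧ ‖p‖ < R) := by
      rw [(isOpen_roundAnnulus r R).frontier_eq] at hpf
      exact hpf.2
    rw [not_and_or, not_lt, not_lt] at hpA
    rcases hpA with hpr | hpR
    · exact Or.inr (hp.unique (hn.sub_of_norm_lt fun y => hpr.trans_lt (hUA (hΦ.mem _)).1))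
    · exact Or.inl (hp.unique (HasWinding.sub_of_lt_norm (hΦ.continuous_curve s) hn.periodic
        fun y => (hUA (hΦ.mem _)).2.trans_le hpR))

end IsAnnularChart

theorem exists_log_union {U V : Set ℂ} (hU : IsOpen U) (hV : IsOpen V) (hd : Disjoint U V)
    {h : ℂ → ℂ} (hLU : ∃ L : ℂ → ℂ, ContinuousOn L U ∧ ∀ z ∈ U, Complex.exp (L z) = h z)
    (hLV : ∃ L : ℂ → ℂ, ContinuousOn L V ∧ ∀ z ∈ V, Complex.exp (L z) = h z) :
    ∃ L : ℂ → ℂ, ContinuousOn L (U ∪ V) ∧ ∀ z ∈ U ∪ V, Complex.exp (L z) = h z := by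
  classical
  obtain ⟨L, hL, hLe⟩ := hLU
  obtain ⟨M, hM, hMe⟩ := hLV
  have h1 : Set.EqOn (U.piecewise L M) L U := fun z hz => Set.piecewise_eq_of_mem _ _ _ hz
  have h2 : Set.EqOn (U.piecewise L M) M V := fun z hz =>
    Set.piecewise_eq_of_notMem _ _ _ (Set.disjoint_right.1 hd hz)
  refine ⟨U.piecewise L M, (hL.congr h1).union_of_isOpen (hM.congr h2) hU hV, ?_⟩
  rintro z (hz | hz)
  · rw [h1 hz, hLe z hz]
  · rw [h2 hz, hMe z hz]

/-- If `k` and `k'` are separated by `U ∪ V` from the boundary of a round annulus, each core curve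
of `U` reaches the circle through `k` from inside or the circle through `k'` from outside. -/
theorem IsAnnularChart.exists_norm_le_or_le_norm {r R : ℝ} (hr : 0 < r) {U V : Set ℂ}
    {Φ Ψ : ℝ × ℝ → ℂ} (hΦ : IsAnnularChart Φ U) (hΨ : IsAnnularChart Ψ V) (hd : Disjoint U V)
    (hU : IsHomotopicallyNontrivialIn U (roundAnnulus r R))
    (hV : IsHomotopicallyNontrivialIn V (roundAnnulus r R)) {k k' : ℂ}
    (hk : k ∈ separatedPart (roundAnnulus r R) (U ∪ V))
    (hk' : k' ∈ separatedPart (roundAnnulus r R) (U ∪ V)) (s : ℝ) :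
    (∃ y, ‖Φ (s, y)‖ ≤ ‖k‖) ∨ ∃ y, ‖k'‖ ≤ ‖Φ (s, y)‖ := by
  by_contra! ⟨h1, h2⟩
  have hUA := hU.1
  have hVA := hV.1
  obtain ⟨⟨hkA, hkS⟩, -⟩ := id hk
  obtain ⟨⟨hkA', hkS'⟩, -⟩ := id hk'
  rw [Set.mem_union, not_or] at hkS hkS'
  obtain ⟨n, hn0, hn⟩ := hΦ.exists_winding_ne_zero hr hU
  obtain ⟨m, hm0, hm⟩ := hΨ.exists_winding_ne_zero hr hV
  have hnk : HasWinding (fun y => Φ (s, y) - k) n := (hn s).sub_of_norm_lt h1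
  have hnk' : HasWinding (fun y => Φ (s, y) - k') 0 :=
    HasWinding.sub_of_lt_norm (hΦ.continuous_curve s) (hn s).periodic h2
  obtain ⟨l, hl⟩ := hΨ.exists_winding_sub hkS.2
  obtain ⟨l', hl'⟩ := hΨ.exists_winding_sub hkS'.2
  -- The two equations say that the winding vanishes along both annuli. Since `l` and `l'` can only
  -- be 0 or `m`, explicit exponents with a + a' ≠ 0 exist in each case.
  have key : ∀ a a' b : ℤ, a + a' ≠ 0 → a * n + a' * 0 + b * n = 0 →
      a * l + a' * l' + b * m = 0 → False := by
    intro a a' b ha e1 e2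
    exact not_exists_log_of_mem_separatedPart hr (hΦ.isOpen.union hΨ.isOpen)
      (Set.union_subset hUA hVA) hk hk' ha (exists_log_union hΦ.isOpen hΨ.isOpen hd
        (hΦ.exists_log_of_winding hr hUA hkS.1 hkS'.1 (hn s) hnk hnk' e1)
        (hΨ.exists_log_of_winding hr hVA hkS.2 hkS'.2 (hm s) (hl s) (hl' s) e2))
  rcases hΨ.winding_eq_zero_or_eq hr hVA hm0 (hm s) hkA hkS.2 (hl s) with rfl | rfl
  · rcases hΨ.winding_eq_zero_or_eq hr hVA hm0 (hm s) hkA' hkS'.2 (hl' s) with rfl | rfl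
    · exact key 0 1 0 (by norm_num) (by ring) (by ring)
    · exact key 1 1 (-1) (by norm_num) (by ring) (by ring)
  · exact key 1 0 (-1) (by norm_num) (by ring) (by ring)

/-! ### Lengths of winding curves and the length–area inequality. -/

open MeasureTheory

/-- The derivative of a continuous logarithm. -/
theorem hasDerivAt_of_exp_eq {γ G : ℝ → ℂ} {γ' : ℂ} {y : ℝ} (hG : ContinuousAt G y)
    (he : ∀ x, Complex.exp (G x) = γ x) (hγ : HasDerivAt γ γ' y) :
    HasDerivAt G (γ' / γ y) y := by
  have h0 : γ y ≠ 0 := by rw [← he]; exact Complex.exp_ne_zero _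
  have h1 : HasDerivAt (fun x => G y + Complex.log (γ x / γ y)) (γ' / γ y) y := by
    have h2 : HasDerivAt (fun x => γ x / γ y) (γ' / γ y) y := hγ.div_const _
    have h3 := h2.clog_real (by rw [div_self h0]; exact Complex.one_mem_slitPlane)
    rw [div_self h0, div_one] at h3
    exact h3.const_add _
  refine h1.congr_of_eventuallyEq ?_
  filter_upwards [hG (Metric.ball_mem_nhds (G y) Real.pi_pos)] with x hx
  have hx' : ‖G x - G y‖ < Real.pi := mem_ball_iff_norm.1 hx
  have him := (Complex.abs_im_le_norm _).trans_lt hx'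
  rw [abs_lt] at him
  rw [← he x, ← he y, ← Complex.exp_sub, Complex.log_exp him.1 him.2.le]
  ring

theorem enorm_sub_le_lintegral_of_hasDerivAt {G G' : ℝ → ℂ} (h : ∀ y, HasDerivAt G (G' y) y)
    (hc : Continuous G') {p q : ℝ} (hpq : p ≤ q) :
    ‖G q - G p‖ₑ ≤ ∫⁻ y in Set.Ioc p q, ‖G' y‖ₑ := by
  rw [← intervalIntegral.integral_eq_sub_of_hasDerivAt (fun y _ => h y)
    (hc.intervalIntegrable _ _), intervalIntegral.integral_of_le hpq]
  exact enorm_integral_le_lintegral_enorm _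

/-- A curve that winds around the origin has logarithmic length at least `2π`, and more if its
distance to the origin varies. -/
theorem HasWinding.le_lintegral {γ γ' : ℝ → ℂ} {n : ℤ} (hn0 : n ≠ 0) (hw : HasWinding γ n)
    (hγ : ∀ y, HasDerivAt γ (γ' y) y) (hγ' : Continuous γ') {d : ℝ} (hd : 0 ≤ d) {y₀ y₁ : ℝ}
    (hy : d ≤ |Real.log ‖γ y₁‖ - Real.log ‖γ y₀‖|) :
    ENNReal.ofReal (2 * √(Real.pi ^ 2 + d ^ 2)) ≤
      ∫⁻ y in Set.Ioc 0 (2 * Real.pi), ‖γ' y / γ y‖ₑ := by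
  have hper : Function.Periodic γ (2 * Real.pi) := hw.periodic
  have h2pi : 0 < 2 * Real.pi := by positivity
  obtain ⟨p, q, hp, hpq, hq, hpqd⟩ : ∃ p q, 0 ≤ p ∧ p ≤ q ∧ q ≤ 2 * Real.pi ∧
      d ≤ |Real.log ‖γ q‖ - Real.log ‖γ p‖| := by
    obtain ⟨x₀, hx₀, h0⟩ := hper.exists_mem_Ico₀ h2pi y₀
    obtain ⟨x₁, hx₁, h1⟩ := hper.exists_mem_Ico₀ h2pi y₁
    rw [h0, h1] at hy
    rcases le_total x₀ x₁ with h | h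
    · exact ⟨x₀, x₁, hx₀.1, h, hx₁.2.le, hy⟩
    · exact ⟨x₁, x₀, hx₁.1, h, hx₀.2.le, by rwa [abs_sub_comm]⟩
  have h0 := hw.ne_zero
  have hc := hw.continuous
  obtain ⟨G, hG, hGe, hGp⟩ := hw
  have hder : ∀ y, HasDerivAt G (γ' y / γ y) y := fun y =>
    hasDerivAt_of_exp_eq hG.continuousAt hGe (hγ y)
  have hlen := fun {p q : ℝ} (h : p ≤ q) =>
    enorm_sub_le_lintegral_of_hasDerivAt hder (hγ'.div hc h0) h
  have hsplit : ∫⁻ y in Set.Ioc 0 (2 * Real.pi), ‖γ' y / γ y‖ₑ =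
      (∫⁻ y in Set.Ioc 0 p, ‖γ' y / γ y‖ₑ) + (∫⁻ y in Set.Ioc p q, ‖γ' y / γ y‖ₑ) +
        ∫⁻ y in Set.Ioc q (2 * Real.pi), ‖γ' y / γ y‖ₑ := by
    rw [← lintegral_union measurableSet_Ioc (Set.Ioc_disjoint_Ioc_of_le le_rfl),
      Set.Ioc_union_Ioc_eq_Ioc hp hpq,
      ← lintegral_union measurableSet_Ioc (Set.Ioc_disjoint_Ioc_of_le le_rfl),
      Set.Ioc_union_Ioc_eq_Ioc (hp.trans hpq) hq]
  rw [hsplit]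
  refine le_trans ?_ (add_le_add (add_le_add (hlen hp) (hlen hpq)) (hlen hq))
  have hre : ∀ y, (G y).re = Real.log ‖γ y‖ := fun y => by
    rw [← hGe, Complex.norm_exp, Real.log_exp]
  have hend : G (2 * Real.pi) = G 0 + n * (2 * Real.pi * Complex.I) := by
    have := hGp 0
    rwa [zero_add] at this
  simp only [← ofReal_norm]
  rw [← ENNReal.ofReal_add (norm_nonneg _) (norm_nonneg _), ← ENNReal.ofReal_add (by positivity)
    (norm_nonneg _)]
  apply ENNReal.ofReal_le_ofReal
  set D := G q - G p
  have hDre : d ≤ |D.re| := by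
    rw [Complex.sub_re, hre, hre]; exact hpqd
  have h1 : ‖n * (2 * Real.pi * Complex.I) - D‖ ≤ ‖G p - G 0‖ + ‖G (2 * Real.pi) - G q‖ := by
    rw [hend]
    refine le_trans (le_of_eq ?_) (norm_add_le _ _)
    congr 1
    simp only [D]
    ring
  -- Reflection trick: replacing the middle increment `D` by its mirror image `-conj D` keeps its
  -- length, and the total displacement becomes 2πin - 2 Re D, whose norm is 2√(π²n² + (Re D)²).
  have h2 : ‖n * (2 * Real.pi * Complex.I) - 2 * D.re‖ ≤
      ‖n * (2 * Real.pi * Complex.I) - D‖ + ‖(starRingEnd ℂ) D‖ := by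
    refine le_trans (le_of_eq ?_) (norm_sub_le _ _)
    congr 1
    have := Complex.add_conj D
    push_cast at this
    rw [← this]
    ring
  rw [RCLike.norm_conj] at h2
  have h3 : 2 * √(Real.pi ^ 2 + d ^ 2) ≤ ‖n * (2 * Real.pi * Complex.I) - 2 * D.re‖ := by
    have hn1 : (1 : ℝ) ≤ (n : ℝ) ^ 2 := by
      have : (1 : ℤ) ≤ n ^ 2 := by have := sq_pos_of_ne_zero hn0; omega
      exact_mod_cast this
    have hsq : d ^ 2 ≤ D.re ^ 2 := by
      rw [← sq_abs D.re]
      exact pow_le_pow_left₀ hd hDre 2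
    refine le_of_sq_le_sq ?_ (norm_nonneg _)
    rw [mul_pow, Real.sq_sqrt (by positivity), ← Complex.normSq_eq_norm_sq, Complex.normSq_apply]
    simp
    nlinarith [sq_nonneg Real.pi]
  linarith

/-- The length-area inequality for a family of vertical segments. -/
theorem ofReal_le_lintegral_sq_of_injOn {m l : ℝ} (hm : 0 ≤ m) (hl : 0 < l) {φ φ' : ℂ → ℂ}
    (hφ : ∀ w ∈ Set.Ioo 0 m ×ℂ Set.Ioo 0 l, HasDerivAt φ (φ' w) w)
    (hinj : Set.InjOn φ (Set.Ioo 0 m ×ℂ Set.Ioo 0 l))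
    (hφ' : AEMeasurable φ' (volume.restrict (Set.Ioo 0 m ×ℂ Set.Ioo 0 l)))
    {σ : ℂ → ENNReal} (hσ : Measurable σ)
    (hlen : ∀ t ∈ Set.Ioo 0 m, ENNReal.ofReal l ≤
      ∫⁻ y in Set.Ioo 0 l, σ (φ (t + y * Complex.I)) * ‖φ' (t + y * Complex.I)‖ₑ) :
    ENNReal.ofReal (l * m) ≤ ∫⁻ z in φ '' (Set.Ioo 0 m ×ℂ Set.Ioo 0 l), σ z ^ 2 := by
  set Q := Set.Ioo 0 m ×ℂ Set.Ioo 0 l with hQdef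
  have hQ : MeasurableSet Q := (isOpen_Ioo.reProdIm isOpen_Ioo).measurableSet
  have hφm : AEMeasurable φ (volume.restrict Q) :=
    (ContinuousOn.aestronglyMeasurable (fun w hw => (hφ w hw).continuousAt.continuousWithinAt)
      hQ).aemeasurable
  set F : ℂ → ENNReal := fun w => σ (φ w) * ‖φ' w‖ₑ with hF
  have hFm : AEMeasurable F (volume.restrict Q) := (hσ.comp_aemeasurable hφm).mul hφ'.enorm
  have harea : ∫⁻ z in φ '' Q, σ z ^ 2 = ∫⁻ w in Q, F w ^ 2 := by
    rw [lintegral_image_eq_lintegral_abs_det_fderiv_mul volume hQ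
      (fun w hw => ((hφ w hw).hasFDerivAt.restrictScalars ℝ).hasFDerivWithinAt) hinj]
    refine setLIntegral_congr_fun hQ fun w _ => ?_
    have hdet : (ContinuousLinearMap.restrictScalars ℝ
        (ContinuousLinearMap.toSpanSingleton ℂ (φ' w))).det = ‖φ' w‖ ^ 2 := by
      rw [ContinuousLinearMap.det, ContinuousLinearMap.coe_restrictScalars,
        LinearMap.det_restrictScalars, ← Complex.normSq_eq_norm_sq]
      simp [Algebra.norm_complex_apply]
    simp only [hF]
    rw [hdet, abs_of_nonneg (sq_nonneg _), ENNReal.ofReal_pow (norm_nonneg _), ofReal_norm,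
      mul_pow, mul_comm]
  have hpre : Complex.measurableEquivRealProd.symm ⁻¹' Q = Set.Ioo 0 m ×ˢ Set.Ioo 0 l := by
    ext p
    simp [hQdef, Complex.mem_reProdIm]
  have hprod : ∀ H : ℂ → ENNReal, ∫⁻ w in Q, H w =
      ∫⁻ p in Set.Ioo 0 m ×ˢ Set.Ioo 0 l, H (p.1 + p.2 * Complex.I) := by
    intro H
    rw [← (Complex.volume_preserving_equiv_real_prod.symm).setLIntegral_comp_preimage_emb
      Complex.measurableEquivRealProd.symm.measurableEmbedding, hpre]
    refine lintegral_congr fun p => ?_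
    rw [Complex.measurableEquivRealProd_symm_apply, Complex.mk_eq_add_mul_I]
  have hvol : volume Q = ENNReal.ofReal (l * m) := by
    have := hprod 1
    simp only [Pi.one_apply, lintegral_one, Measure.restrict_apply_univ] at this
    rw [this, Measure.volume_eq_prod, Measure.prod_prod, Real.volume_Ioo, Real.volume_Ioo,
      ← ENNReal.ofReal_mul (by linarith), sub_zero, sub_zero, mul_comm]
  have hlower : ENNReal.ofReal (l * m) ≤ ∫⁻ w in Q, F w := by
    have hm' : AEMeasurable (fun p : ℝ × ℝ => F (p.1 + p.2 * Complex.I))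
        ((volume.restrict (Set.Ioo 0 m)).prod (volume.restrict (Set.Ioo 0 l))) := by
      rw [Measure.prod_restrict, ← Measure.volume_eq_prod]
      have h1 := (Complex.volume_preserving_equiv_real_prod.symm).restrict_preimage hQ
      rw [hpre] at h1
      convert hFm.comp_quasiMeasurePreserving h1.quasiMeasurePreserving using 1
      ext p
      simp only [Function.comp_apply]
      rw [Complex.measurableEquivRealProd_symm_apply, Complex.mk_eq_add_mul_I]
    rw [hprod, Measure.volume_eq_prod, ← Measure.prod_restrict, lintegral_prod _ hm']
    calc ENNReal.ofReal (l * m) = ∫⁻ _ in Set.Ioo 0 m, ENNReal.ofReal l := by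
          rw [setLIntegral_const, Real.volume_Ioo, sub_zero, ENNReal.ofReal_mul hl.le]
      _ ≤ _ := setLIntegral_mono' measurableSet_Ioo hlen
  -- The pointwise bound 2F ≤ 1 + F² replaces Cauchy–Schwarz without loss, because the required
  -- length equals the Euclidean length `l` of the segments.
  have hamgm : 2 * ∫⁻ w in Q, F w ≤ ENNReal.ofReal (l * m) + ∫⁻ w in Q, F w ^ 2 := by
    rw [← hvol, ← setLIntegral_one, ← lintegral_add_left measurable_const,
      ← lintegral_const_mul' _ _ (by simp)]
    refine lintegral_mono fun w => ?_
    rcases eq_or_ne (F w) ⊤ with h | h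
    · simp [h]
    · have := two_mul_le_add_sq (1 : NNReal) (F w).toNNReal
      lift F w to NNReal using h with x
      simp only [ENNReal.toNNReal_coe, one_pow, mul_one] at this
      exact_mod_cast this
  rw [harea]
  have h2 : ENNReal.ofReal (l * m) + ENNReal.ofReal (l * m) ≤
      ENNReal.ofReal (l * m) + ∫⁻ w in Q, F w ^ 2 := by
    refine le_trans ?_ hamgm
    rw [two_mul]
    exact add_le_add hlower hlower
  exact (ENNReal.add_le_add_iff_left ENNReal.ofReal_ne_top).1 h2

theorem lintegral_roundAnnulus {a b : ℝ} (ha : 0 < a) (hab : a ≤ b) :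
    ∫⁻ z in roundAnnulus a b, ENNReal.ofReal (‖z‖⁻¹) ^ 2 =
      ENNReal.ofReal (2 * Real.pi * (Real.log b - Real.log a)) := by
  have hmeas := (isOpen_roundAnnulus a b).measurableSet
  rw [← lintegral_indicator hmeas, ← Complex.lintegral_comp_polarCoord_symm]
  have hT : polarCoord.target = Set.Ioi (0 : ℝ) ×ˢ Set.Ioo (-Real.pi) Real.pi := rfl
  have h1 : ∀ p ∈ polarCoord.target, ENNReal.ofReal p.1 • (roundAnnulus a b).indicator
      (fun z => ENNReal.ofReal (‖z‖⁻¹) ^ 2) (Complex.polarCoord.symm p) =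
      (Set.Ioo a b).indicator (fun x => ENNReal.ofReal x⁻¹) p.1 := by
    rintro ⟨x, y⟩ hp
    have hx : 0 < x := hp.1
    have hnorm : ‖Complex.polarCoord.symm (x, y)‖ = x := by
      rw [Complex.norm_polarCoord_symm, abs_of_pos hx]
    by_cases hxab : x ∈ Set.Ioo a b
    · rw [Set.indicator_of_mem hxab, Set.indicator_of_mem (by
        rw [roundAnnulus, Set.mem_ofPred_eq, hnorm]; exact hxab), hnorm, smul_eq_mul,
        ← ENNReal.ofReal_pow (by positivity), ← ENNReal.ofReal_mul hx.le]
      congr 1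
      field_simp
    · rw [Set.indicator_of_notMem hxab, Set.indicator_of_notMem (by
        rw [roundAnnulus, Set.mem_ofPred_eq, hnorm]; exact hxab), smul_zero]
  rw [setLIntegral_congr_fun polarCoord.open_target.measurableSet h1, hT,
    Measure.volume_eq_prod, ← Measure.prod_restrict]
  have hm1 : Measurable fun x : ℝ => (Set.Ioo a b).indicator (fun x => ENNReal.ofReal x⁻¹) x :=
    (by fun_prop : Measurable fun x : ℝ => ENNReal.ofReal x⁻¹).indicator measurableSet_Ioo
  rw [lintegral_prod (fun p : ℝ × ℝ => (Set.Ioo a b).indicator (fun x => ENNReal.ofReal x⁻¹) p.1)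
    (hm1.comp measurable_fst).aemeasurable]
  simp only [lintegral_const, Measure.restrict_apply_univ, Real.volume_Ioo]
  rw [lintegral_mul_const _ hm1, lintegral_indicator measurableSet_Ioo,
    Measure.restrict_restrict measurableSet_Ioo,
    Set.inter_eq_left.2 (show Set.Ioo a b ⊆ Set.Ioi 0 from fun x hx => ha.trans hx.1)]
  have hint : IntegrableOn (fun x : ℝ => x⁻¹) (Set.Ioo a b) := by
    have : ContinuousOn (fun x : ℝ => x⁻¹) (Set.Icc a b) :=
      continuousOn_inv₀.mono fun x hx => (ha.trans_le hx.1).ne'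
    exact this.integrableOn_Icc.mono_set Set.Ioo_subset_Icc_self
  rw [← ofReal_integral_eq_lintegral_ofReal hint, ← integral_Ioc_eq_integral_Ioo,
    ← intervalIntegral.integral_of_le hab, integral_inv_of_pos ha (ha.trans_le hab),
    Real.log_div (ha.trans_le hab).ne' ha.ne', ← ENNReal.ofReal_mul' (by linarith [Real.pi_pos])]
  · congr 1; ring
  · filter_upwards [ae_restrict_mem measurableSet_Ioo] with x hx
    exact inv_nonneg.2 (ha.trans hx.1).le

/-! ### The shrunk metric: lengths and area. -/

/-- The factor by which the logarithmic metric may be shrunk in the middle half of a cylinder of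
height `g` without making a curve shorter than `2π` that leaves the cylinder. -/
noncomputable def shrinkFactor (g : ℝ) : ℝ := Real.pi / √(Real.pi ^ 2 + (g / 4) ^ 2)

theorem shrinkFactor_pos (g : ℝ) : 0 < shrinkFactor g := by
  unfold shrinkFactor
  positivity

theorem shrinkFactor_sq (g : ℝ) :
    shrinkFactor g ^ 2 = Real.pi ^ 2 / (Real.pi ^ 2 + (g / 4) ^ 2) := by
  rw [shrinkFactor, div_pow, Real.sq_sqrt (by positivity)]

theorem shrinkFactor_sq_le_one (g : ℝ) : shrinkFactor g ^ 2 ≤ 1 := by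
  rw [shrinkFactor_sq, div_le_one (by positivity)]
  nlinarith [sq_nonneg (g / 4)]

theorem shrinkFactor_le_one (g : ℝ) : shrinkFactor g ≤ 1 := by
  have := shrinkFactor_sq_le_one g
  nlinarith [shrinkFactor_pos g]

open Classical in
/-- The logarithmic metric, shrunk in the middle half of the cylinder `a < |z| < a exp g`. -/
noncomputable def bandMetric (a g : ℝ) (z : ℂ) : ENNReal :=
  ENNReal.ofReal ((if z ∈ roundAnnulus (a * Real.exp (g / 4)) (a * Real.exp (3 * g / 4))
    then shrinkFactor g else 1) * ‖z‖⁻¹)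

theorem measurable_bandMetric (a g : ℝ) : Measurable (bandMetric a g) := by
  unfold bandMetric
  exact ((Measurable.ite (isOpen_roundAnnulus _ _).measurableSet measurable_const
    measurable_const).mul (by fun_prop)).ennreal_ofReal

/-- A curve missing the shrunk part keeps its logarithmic length. One that meets it must cross a
quarter of the cylinder to get out, and the extra length cancels `shrinkFactor g`. -/
theorem le_lintegral_bandMetric_curve {γ γ' : ℝ → ℂ} {n : ℤ} (hn0 : n ≠ 0) (hw : HasWinding γ n)
    (hγ : ∀ y, HasDerivAt γ (γ' y) y) (hγ' : Continuous γ') {a g : ℝ} (ha : 0 < a) (hg : 0 ≤ g)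
    (hexit : (∃ y, ‖γ y‖ ≤ a) ∨ ∃ y, a * Real.exp g ≤ ‖γ y‖) :
    ENNReal.ofReal (2 * Real.pi) ≤
      ∫⁻ y in Set.Ioc 0 (2 * Real.pi), bandMetric a g (γ y) * ‖γ' y‖ₑ := by
  have h0 := hw.ne_zero
  by_cases hB : ∃ y₀, γ y₀ ∈ roundAnnulus (a * Real.exp (g / 4)) (a * Real.exp (3 * g / 4))
  · obtain ⟨y₀, hy₀⟩ := hB
    have hlog : ∀ x, Real.log (a * Real.exp x) = Real.log a + x := fun x => by
      rw [Real.log_mul ha.ne' (Real.exp_ne_zero x), Real.log_exp]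
    have hl1 := Real.log_le_log (by positivity) hy₀.1.le
    have hl2 := Real.log_le_log (norm_pos_iff.2 (h0 _)) hy₀.2.le
    rw [hlog] at hl1 hl2
    obtain ⟨y₁, hy₁⟩ : ∃ y₁, g / 4 ≤ |Real.log ‖γ y₁‖ - Real.log ‖γ y₀‖| := by
      rcases hexit with ⟨y, hy⟩ | ⟨y, hy⟩
      · have := Real.log_le_log (norm_pos_iff.2 (h0 _)) hy
        exact ⟨y, le_abs.2 (Or.inr (by linarith))⟩
      · have := Real.log_le_log (by positivity) hy
        rw [hlog] at this
        exact ⟨y, le_abs.2 (Or.inl (by linarith))⟩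
    have hlen := hw.le_lintegral hn0 hγ hγ' (by positivity) hy₁
    have hpt : ∀ y, ENNReal.ofReal (shrinkFactor g) * ‖γ' y / γ y‖ₑ ≤
        bandMetric a g (γ y) * ‖γ' y‖ₑ := by
      intro y
      rw [← ofReal_norm, ← ofReal_norm, ← ENNReal.ofReal_mul (shrinkFactor_pos g).le, bandMetric,
        ← ENNReal.ofReal_mul' (norm_nonneg _), norm_div]
      apply ENNReal.ofReal_le_ofReal
      have : shrinkFactor g * (‖γ' y‖ / ‖γ y‖) = shrinkFactor g * ‖γ y‖⁻¹ * ‖γ' y‖ := by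
        rw [div_eq_mul_inv]; ring
      rw [this]
      gcongr
      split_ifs
      · exact le_rfl
      · exact shrinkFactor_le_one g
    refine le_trans ?_ (lintegral_mono hpt)
    rw [lintegral_const_mul' _ _ ENNReal.ofReal_ne_top]
    refine le_trans (le_of_eq ?_) (mul_le_mul_right hlen _)
    rw [← ENNReal.ofReal_mul (shrinkFactor_pos g).le, shrinkFactor]
    congr 1
    have : 0 < √(Real.pi ^ 2 + (g / 4) ^ 2) := by positivity
    field_simp
  · have hlen := hw.le_lintegral hn0 hγ hγ' le_rfl (y₀ := 0) (y₁ := 0) (by simp)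
    have hsq : 2 * √(Real.pi ^ 2 + 0 ^ 2) = 2 * Real.pi := by
      rw [zero_pow two_ne_zero, add_zero, Real.sqrt_sq Real.pi_pos.le]
    rw [hsq] at hlen
    refine hlen.trans (lintegral_mono fun y => ?_)
    rw [bandMetric, if_neg (fun h => hB ⟨y, h⟩), one_mul, ← ofReal_norm, ← ofReal_norm,
      ← ENNReal.ofReal_mul' (norm_nonneg _), norm_div, div_eq_inv_mul]

/-- The length-area bound for the modulus of a conformal annulus whose core curves wind around the
origin and leave the cylinder `a < |z| < a exp g`. -/
theorem le_lintegral_bandMetric_of_conformal {m : ℝ} (hm : 0 < m) {f : ℂ → ℂ} {U : Set ℂ}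
    (hd : DifferentiableOn ℂ f (roundAnnulus 1 (Real.exp m)))
    (hf : Set.BijOn f (roundAnnulus 1 (Real.exp m)) U) {n : ℤ} (hn0 : n ≠ 0)
    (hw : ∀ s, HasWinding (fun y => f (roundChart m (s, y))) n) {a g : ℝ} (ha : 0 < a)
    (hg : 0 ≤ g) (hexit : ∀ s, (∃ y, ‖f (roundChart m (s, y))‖ ≤ a) ∨
      ∃ y, a * Real.exp g ≤ ‖f (roundChart m (s, y))‖) :
    ENNReal.ofReal (2 * Real.pi * m) ≤ ∫⁻ z in U, bandMetric a g z ^ 2 := by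
  have hstrip : IsOpen {w : ℂ | 0 < w.re ∧ w.re < m} :=
    (isOpen_lt continuous_const Complex.continuous_re).inter
      (isOpen_lt Complex.continuous_re continuous_const)
  have hdφ : DifferentiableOn ℂ (fun w => f (Complex.exp w)) {w : ℂ | 0 < w.re ∧ w.re < m} :=
    hd.comp Complex.differentiable_exp.differentiableOn
      fun w hw => exp_mem_roundAnnulus_one_exp.2 hw
  have hder : ∀ w ∈ {w : ℂ | 0 < w.re ∧ w.re < m},
      HasDerivAt (fun w => f (Complex.exp w)) (deriv (fun w => f (Complex.exp w)) w) w :=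
    fun w hw => (hdφ.differentiableAt (hstrip.mem_nhds hw)).hasDerivAt
  have hderc := (hdφ.deriv hstrip).continuousOn
  -- The rectangle of width `m` and height 2π is the annulus cut along a radius, so its image has at
  -- most the area of `U`.
  refine (ofReal_le_lintegral_sq_of_injOn (φ := fun w => f (Complex.exp w)) hm.le (by positivity)
    (fun w hw => hder w ⟨hw.1.1, hw.1.2⟩) ?_ (measurable_deriv _).aemeasurable
    (measurable_bandMetric a g) ?_).trans (lintegral_mono_set ?_)
  · intro w hw w' hw' h
    have hexp := hf.injOn (exp_mem_roundAnnulus_one_exp.2 ⟨hw.1.1, hw.1.2⟩)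
      (exp_mem_roundAnnulus_one_exp.2 ⟨hw'.1.1, hw'.1.2⟩) h
    obtain ⟨k, hk⟩ := Complex.exp_eq_exp_iff_exists_int.1 hexp
    have him := congrArg Complex.im hk
    simp at him
    have h1 := hw.2
    have h2 := hw'.2
    simp only [Set.mem_preimage, Set.mem_Ioo] at h1 h2
    have hpi := Real.pi_pos
    have hk1 : (k : ℝ) < 1 := by
      by_contra hcon
      nlinarith
    have hk2 : (-1 : ℝ) < k := by
      by_contra hcon
      nlinarith
    have hk0 : k = 0 := by
      have h3 : k < 1 := by exact_mod_cast hk1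
      have h4 : -1 < k := by exact_mod_cast hk2
      omega
    rw [hk, hk0]
    simp
  · intro t ht
    obtain ⟨s, hs⟩ := exists_mul_sigmoid ht.1 ht.2
    have hline : ∀ y : ℝ, (t + y * Complex.I : ℂ) ∈ {w : ℂ | 0 < w.re ∧ w.re < m} := fun y => by
      simpa using ht
    have hcurve : (fun y => f (roundChart m (s, y))) =
        fun y : ℝ => f (Complex.exp (t + y * Complex.I)) := by
      ext y
      rw [roundChart, hs]
    have hws := hw s
    have hes := hexit s
    rw [hcurve] at hws
    simp only [roundChart, hs] at hes
    have hlen := le_lintegral_bandMetric_curve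
      (γ' := fun y => deriv (fun w => f (Complex.exp w)) (t + y * Complex.I) * Complex.I) hn0 hws
      (fun y => by
        have h1 : HasDerivAt (fun y : ℝ => (t + y * Complex.I : ℂ)) Complex.I y := by
          simpa using ((Complex.ofRealCLM.hasDerivAt (x := y)).mul_const Complex.I).const_add (t : ℂ)
        exact HasDerivAt.comp (h₂ := fun w => f (Complex.exp w)) y (hder _ (hline y)) h1)
      ((hderc.comp_continuous (by fun_prop) hline).mul continuous_const) ha hg hes
    rw [setLIntegral_congr Ioo_ae_eq_Ioc]
    have hI : ‖Complex.I‖ₑ = 1 := by rw [← ofReal_norm, Complex.norm_I, ENNReal.ofReal_one]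
    simpa [enorm_mul, hI] using hlen
  · rintro _ ⟨w, hw, rfl⟩
    exact hf.mapsTo (exp_mem_roundAnnulus_one_exp.2 ⟨hw.1.1, hw.1.2⟩)

/-- The middle half has logarithmic area 2π · g/2, of which the fraction 1 - `shrinkFactor g` ^ 2 is
lost. -/
theorem lintegral_bandMetric_le {r R a g : ℝ} (hr : 0 < r) (hrR : r < R) (ha : 0 < a) (hg : 0 ≤ g)
    (hra : r ≤ a) (haR : a * Real.exp g ≤ R) :
    ∫⁻ z in roundAnnulus r R, bandMetric a g z ^ 2 ≤ ENNReal.ofReal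
      (2 * Real.pi * (Real.log R - Real.log r - g / 2 * (1 - shrinkFactor g ^ 2))) := by
  set B := roundAnnulus (a * Real.exp (g / 4)) (a * Real.exp (3 * g / 4)) with hB
  have hBm : MeasurableSet B := (isOpen_roundAnnulus _ _).measurableSet
  have hle := shrinkFactor_sq_le_one g
  have hBA : B ⊆ roundAnnulus r R := by
    intro z hz
    have h1 : 1 ≤ Real.exp (g / 4) := Real.one_le_exp (by positivity)
    have h2 : Real.exp (3 * g / 4) ≤ Real.exp g := Real.exp_le_exp.2 (by linarith)
    exact ⟨by nlinarith [hz.1], by nlinarith [hz.2]⟩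
  have hpt : ∀ z, ENNReal.ofReal (‖z‖⁻¹) ^ 2 = bandMetric a g z ^ 2 +
      B.indicator (fun z => ENNReal.ofReal (1 - shrinkFactor g ^ 2) * ENNReal.ofReal (‖z‖⁻¹) ^ 2)
        z := by
    intro z
    have hσ := (shrinkFactor_pos g).le
    by_cases hz : z ∈ B
    · rw [Set.indicator_of_mem hz, bandMetric, if_pos hz, ← ENNReal.ofReal_pow (by positivity),
        ← ENNReal.ofReal_pow (by positivity), ← ENNReal.ofReal_mul (by linarith),
        ← ENNReal.ofReal_add (by positivity) (mul_nonneg (by linarith) (by positivity))]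
      congr 1
      ring
    · rw [Set.indicator_of_notMem hz, bandMetric, if_neg hz, one_mul, add_zero]
  have htot := lintegral_roundAnnulus hr hrR.le
  have hband := lintegral_roundAnnulus (a := a * Real.exp (g / 4)) (b := a * Real.exp (3 * g / 4))
    (by positivity) (by gcongr; linarith)
  rw [← hB, Real.log_mul ha.ne' (Real.exp_ne_zero _), Real.log_mul ha.ne' (Real.exp_ne_zero _),
    Real.log_exp, Real.log_exp] at hband
  rw [lintegral_congr hpt, lintegral_add_left ((measurable_bandMetric a g).pow_const 2),
    lintegral_indicator hBm, Measure.restrict_restrict hBm, Set.inter_eq_left.2 hBA,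
    lintegral_const_mul' _ _ ENNReal.ofReal_ne_top, hband,
    ← ENNReal.ofReal_mul (by linarith)] at htot
  have hpi := Real.pi_pos
  have hnn : 0 ≤ (1 - shrinkFactor g ^ 2) *
      (2 * Real.pi * (Real.log a + 3 * g / 4 - (Real.log a + g / 4))) :=
    mul_nonneg (by linarith) (mul_nonneg (by positivity) (by linarith))
  have := ENNReal.eq_sub_of_add_eq ENNReal.ofReal_ne_top htot
  rw [this, ← ENNReal.ofReal_sub _ hnn]
  apply ENNReal.ofReal_le_ofReal
  linarith

/-! ### From area bounds to moduli. -/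

theorem two_pi_mul_annulusModulus_le {U : Set ℂ} {V : ENNReal} (hV : V ≠ ⊤)
    (h : ∀ m : ℝ, 0 < m → ∀ f : ℂ → ℂ, DifferentiableOn ℂ f (roundAnnulus 1 (Real.exp m)) →
      Set.BijOn f (roundAnnulus 1 (Real.exp m)) U → ENNReal.ofReal (2 * Real.pi * m) ≤ V) :
    2 * Real.pi * annulusModulus U ≤ V.toReal := by
  have hpi : 0 < 2 * Real.pi := by positivity
  rw [mul_comm, ← le_div_iff₀ hpi]
  refine Real.sSup_le ?_ (by positivity)
  rintro m ⟨hm, f, hd, hf⟩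
  rw [le_div_iff₀ hpi, mul_comm]
  exact (ENNReal.ofReal_le_iff_le_toReal hV).1 (h m hm f hd hf)

/-- The core curves of a round annulus, in any chart, wind around the origin. -/
theorem IsAnnularChart.exists_winding_ne_zero_of_roundAnnulus {r R : ℝ} (hr : 0 < r)
    {Φ : ℝ × ℝ → ℂ} (hΦ : IsAnnularChart Φ (roundAnnulus r R)) :
    ∃ n : ℤ, n ≠ 0 ∧ ∀ s, HasWinding (fun y => Φ (s, y)) n := by
  have hU0 : ∀ z ∈ roundAnnulus r R, z ≠ 0 := fun z hz h0 =>
    zero_notMem_roundAnnulus hr (h0 ▸ hz)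
  obtain ⟨n, hn⟩ := hΦ.exists_winding (h := fun z => z) (by fun_prop) hU0
  refine ⟨n, ?_, hn⟩
  rintro rfl
  obtain ⟨L, hL, hLe⟩ := hΦ.exists_log (h := fun z => z) (by fun_prop) hU0 (hn 0)
  have hz := hΦ.mem (0, 0)
  set s := Real.log ‖Φ (0, 0)‖
  have hs : Real.exp s = ‖Φ (0, 0)‖ := Real.exp_log (norm_pos_iff.2 (hU0 _ hz))
  have hmem : ∀ y : ℝ, Complex.exp ((s : ℂ) + y * Complex.I) ∈ roundAnnulus r R := by
    intro y
    have : ‖Complex.exp ((s : ℂ) + y * Complex.I)‖ = ‖Φ (0, 0)‖ := by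
      simp [Complex.norm_exp, hs]
    rw [roundAnnulus, Set.mem_ofPred_eq, this]
    exact hz
  have hc := HasWinding.circle s
  have h0 : HasWinding (fun y => Complex.exp ((s : ℂ) + y * Complex.I)) 0 :=
    ⟨fun y => L (Complex.exp ((s : ℂ) + y * Complex.I)),
      hL.comp_continuous hc.continuous hmem, fun y => hLe _ (hmem y), fun y => by
        simp only [hc.periodic y]; simp⟩
  exact one_ne_zero (hc.unique h0)

/-- Scaling by `r` realises this value; the length–area bound with the unshrunk metric (`g = 0`)
shows that no larger one occurs. -/
theorem annulusModulus_roundAnnulus {r R : ℝ} (hr : 0 < r) (hrR : r < R) :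
    annulusModulus (roundAnnulus r R) = Real.log R - Real.log r := by
  have hpi : 0 < 2 * Real.pi := by positivity
  have hlog : 0 < Real.log R - Real.log r := sub_pos.2 (Real.log_lt_log hr hrR)
  have hbound : ∀ m : ℝ, 0 < m → ∀ f : ℂ → ℂ,
      DifferentiableOn ℂ f (roundAnnulus 1 (Real.exp m)) →
      Set.BijOn f (roundAnnulus 1 (Real.exp m)) (roundAnnulus r R) →
      ENNReal.ofReal (2 * Real.pi * m) ≤
        ENNReal.ofReal (2 * Real.pi * (Real.log R - Real.log r)) := by
    intro m hm f hd hf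
    obtain ⟨n, hn0, hn⟩ :=
      (isAnnularChart_of_conformal hm hd hf).exists_winding_ne_zero_of_roundAnnulus hr
    refine (le_lintegral_bandMetric_of_conformal hm hd hf hn0 hn hr le_rfl fun s => ?_).trans
      ((lintegral_bandMetric_le hr hrR hr le_rfl le_rfl (by simpa using hrR.le)).trans_eq ?_)
    · rw [Real.exp_zero, mul_one]
      exact (le_total ‖f (roundChart m (s, 0))‖ r).imp (fun h => ⟨0, h⟩) fun h => ⟨0, h⟩
    · simp
  refine le_antisymm ?_ (le_csSup ⟨Real.log R - Real.log r, ?_⟩ ⟨hlog, fun z => r * z, by fun_prop,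
    ?_, ?_, ?_⟩)
  · have := two_pi_mul_annulusModulus_le ENNReal.ofReal_ne_top hbound
    rw [ENNReal.toReal_ofReal (by positivity)] at this
    exact le_of_mul_le_mul_left this hpi
  · rintro m ⟨hm, f, hd, hf⟩
    have := hbound m hm f hd hf
    rw [ENNReal.ofReal_le_ofReal_iff (by positivity)] at this
    exact le_of_mul_le_mul_left this hpi
  all_goals
    have hexp : Real.exp (Real.log R - Real.log r) = R / r := by
      rw [Real.exp_sub, Real.exp_log hr, Real.exp_log (hr.trans hrR)]
  · intro z hz
    rw [roundAnnulus, Set.mem_ofPred_eq, hexp, lt_div_iff₀ hr] at hz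
    rw [roundAnnulus, Set.mem_ofPred_eq, norm_mul, Complex.norm_real, Real.norm_of_nonneg hr.le]
    constructor <;> nlinarith [hz.1, hz.2]
  · intro z _ w _ h
    have : (r : ℂ) ≠ 0 := by exact_mod_cast hr.ne'
    exact mul_left_cancel₀ this h
  · intro z hz
    have hr0 : (r : ℂ) ≠ 0 := by exact_mod_cast hr.ne'
    refine ⟨z / r, ?_, by field_simp⟩
    rw [roundAnnulus, Set.mem_ofPred_eq, hexp, norm_div, Complex.norm_real,
      Real.norm_of_nonneg hr.le, lt_div_iff₀ hr, one_mul]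
    exact ⟨hz.1, div_lt_div_of_pos_right hz.2 hr⟩

theorem annulusModulus_empty : annulusModulus ∅ = 0 := by
  have : {m : ℝ | 0 < m ∧ ConformallyEquivalent (roundAnnulus 1 (Real.exp m)) ∅} = ∅ := by
    ext m
    simp only [Set.mem_ofPred_eq, Set.mem_empty_iff_false, iff_false]
    rintro ⟨hm, f, -, hf⟩
    exact hf.mapsTo ((isAnnularChart_roundChart hm).mem (0, 0))
  rw [annulusModulus, this, Real.sSup_empty]

/-- The Grötzsch inequality, with a deficit when all core curves of both annuli leave a common
cylinder. -/
theorem annulusModulus_add_le_of_exit {r R : ℝ} (hr : 0 < r) (hrR : r < R) {U V : Set ℂ}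
    (hU : IsHomotopicallyNontrivialIn U (roundAnnulus r R))
    (hV : IsHomotopicallyNontrivialIn V (roundAnnulus r R)) (hVo : IsOpen V)
    (hd : Disjoint U V) {a g : ℝ} (hg : 0 ≤ g) (hra : r ≤ a) (haR : a * Real.exp g ≤ R)
    (hexit : ∀ Φ, IsAnnularChart Φ U ∨ IsAnnularChart Φ V → ∀ s,
      (∃ y, ‖Φ (s, y)‖ ≤ a) ∨ ∃ y, a * Real.exp g ≤ ‖Φ (s, y)‖) :
    annulusModulus U + annulusModulus V + g / 2 * (1 - shrinkFactor g ^ 2) ≤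
      Real.log R - Real.log r := by
  have ha := hr.trans_le hra
  have hsum : (∫⁻ z in U, bandMetric a g z ^ 2) + ∫⁻ z in V, bandMetric a g z ^ 2 ≤
      ENNReal.ofReal (2 * Real.pi * (Real.log R - Real.log r - g / 2 * (1 - shrinkFactor g ^ 2))) := by
    rw [← lintegral_union hVo.measurableSet hd]
    exact (lintegral_mono_set (Set.union_subset hU.1 hV.1)).trans
      (lintegral_bandMetric_le hr hrR ha hg hra haR)
  have hfinU := ne_top_of_le_ne_top ENNReal.ofReal_ne_top (le_self_add.trans hsum)
  have hfinV := ne_top_of_le_ne_top ENNReal.ofReal_ne_top (le_add_self.trans hsum)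
  have hmU := two_pi_mul_annulusModulus_le hfinU fun m hm f hdf hf => by
    have hΦ := isAnnularChart_of_conformal hm hdf hf
    obtain ⟨n, hn0, hn⟩ := hΦ.exists_winding_ne_zero hr hU
    exact le_lintegral_bandMetric_of_conformal hm hdf hf hn0 hn ha hg (hexit _ (Or.inl hΦ))
  have hmV := two_pi_mul_annulusModulus_le hfinV fun m hm f hdf hf => by
    have hΦ := isAnnularChart_of_conformal hm hdf hf
    obtain ⟨n, hn0, hn⟩ := hΦ.exists_winding_ne_zero hr hV
    exact le_lintegral_bandMetric_of_conformal hm hdf hf hn0 hn ha hg (hexit _ (Or.inr hΦ))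
  -- Without this sign, `ENNReal.ofReal` would truncate the right-hand side to 0.
  have hheight : 0 ≤ Real.log R - Real.log r - g / 2 * (1 - shrinkFactor g ^ 2) := by
    have h1 := Real.log_le_log (mul_pos ha (Real.exp_pos g)) haR
    rw [Real.log_mul ha.ne' (Real.exp_ne_zero g), Real.log_exp] at h1
    have h2 := Real.log_le_log hr hra
    nlinarith [sq_nonneg (shrinkFactor g)]
  have htot := ENNReal.toReal_mono ENNReal.ofReal_ne_top hsum
  rw [ENNReal.toReal_add hfinU hfinV, ENNReal.toReal_ofReal (by positivity)] at htot
  have hpi : 0 < 2 * Real.pi := by positivity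
  have : 2 * Real.pi * (annulusModulus U + annulusModulus V) ≤
      2 * Real.pi * (Real.log R - Real.log r - g / 2 * (1 - shrinkFactor g ^ 2)) := by
    linarith
  linarith [le_of_mul_le_mul_left this hpi]

/-- A subset of a round annulus contains two points whose radii realise at least half of its
concentric modulus. -/
theorem exists_norm_mul_exp_le {r R : ℝ} (hr : 0 < r) {K : Set ℂ} (hK : K ⊆ roundAnnulus r R)
    (h0 : concentricModulus K ≠ 0) :
    0 < concentricModulus K ∧
      ∃ k ∈ K, ∃ k' ∈ K, ‖k‖ * Real.exp (concentricModulus K / 2) ≤ ‖k'‖ := by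
  set x := concentricModulus K with hx
  set a := sInf (norm '' K) with ha
  set b := sSup (norm '' K) with hb
  have hab : a < b := by
    by_contra hab
    apply h0
    have : roundAnnulus a b = ∅ := by
      ext z
      simp only [Set.mem_empty_iff_false, iff_false]
      exact fun hz => hab (hz.1.trans hz.2)
    rw [hx, concentricModulus, ← ha, ← hb, this, annulusModulus_empty]
  have hne : (norm '' K).Nonempty := by
    by_contra hemp
    rw [Set.not_nonempty_iff_eq_empty] at hemp
    simp [ha, hb, hemp] at hab
  have hra : r ≤ a := le_csInf hne (by rintro _ ⟨z, hz, rfl⟩; exact (hK hz).1.le)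
  have ha0 := hr.trans_le hra
  have hb0 := ha0.trans hab
  have hxab : x = Real.log b - Real.log a := annulusModulus_roundAnnulus ha0 hab
  have hx0 : 0 < x := hxab ▸ sub_pos.2 (Real.log_lt_log ha0 hab)
  refine ⟨hx0, ?_⟩
  -- Giving away `x / 4` at each end leaves `x / 2` and avoids proving that the extremal radii are
  -- attained.
  obtain ⟨_, ⟨k, hk, rfl⟩, hka⟩ := exists_lt_of_csInf_lt hne
    (show a < a * Real.exp (x / 4) from lt_mul_of_one_lt_right ha0 (Real.one_lt_exp_iff.2 (by linarith)))
  obtain ⟨_, ⟨k', hk', rfl⟩, hkb⟩ := exists_lt_of_lt_csSup hne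
    (show b * Real.exp (-(x / 4)) < b from
      mul_lt_of_lt_one_right hb0 (Real.exp_lt_one_iff.2 (by linarith)))
  refine ⟨k, hk, k', hk', ?_⟩
  have hexp : a * Real.exp x = b := by
    rw [hxab, Real.exp_sub, Real.exp_log ha0, Real.exp_log hb0]
    field_simp
  calc ‖k‖ * Real.exp (x / 2) ≤ a * Real.exp (x / 4) * Real.exp (x / 2) := by gcongr
    _ = b * Real.exp (-(x / 4)) := by
      rw [← hexp, mul_assoc, mul_assoc, ← Real.exp_add, ← Real.exp_add]
      congr 2
      ring
    _ ≤ ‖k'‖ := hkb.le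

theorem lemma9 :
    ∃ β : ℝ → ℝ, β 0 = 0 ∧ (∀ x : ℝ, 0 < x → 0 < β x) ∧
      ∀ r R : ℝ, 0 < r → r < R →
      ∀ A₁ A₂ : Set ℂ,
        IsTopologicalAnnulus A₁ → IsTopologicalAnnulus A₂ →
        IsHomotopicallyNontrivialIn A₁ (roundAnnulus r R) →
        IsHomotopicallyNontrivialIn A₂ (roundAnnulus r R) →
        Disjoint A₁ A₂ →
        annulusModulus A₁ + annulusModulus A₂
            + β (concentricModulus (separatedPart (roundAnnulus r R) (A₁ ∪ A₂)))
          ≤ annulusModulus (roundAnnulus r R) := by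
  -- This is the area gain, divided by 2π, for a band of height `g = x / 2`.
  refine ⟨fun x => x / 2 / 2 * (1 - shrinkFactor (x / 2) ^ 2), by simp, fun x hx => ?_, ?_⟩
  · have : shrinkFactor (x / 2) ^ 2 < 1 := by
      rw [shrinkFactor_sq, div_lt_one (by positivity)]
      have : 0 < (x / 2 / 4) ^ 2 := by positivity
      linarith
    exact mul_pos (by positivity) (by linarith)
  intro r R hr hrR A₁ A₂ hA₁ hA₂ he₁ he₂ hd
  rw [annulusModulus_roundAnnulus hr hrR]
  rcases eq_or_ne (concentricModulus (separatedPart (roundAnnulus r R) (A₁ ∪ A₂))) 0 with h0 | h0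
  -- A band of height 0 suffices, and every curve leaves it trivially; this also covers empty `K`.
  · rw [h0]
    have := annulusModulus_add_le_of_exit hr hrR he₁ he₂ hA₂.1 hd le_rfl le_rfl
      (by simpa using hrR.le) fun Φ _ s => by
        rw [Real.exp_zero, mul_one]
        exact (le_total ‖Φ (s, 0)‖ r).imp (fun h => ⟨0, h⟩) fun h => ⟨0, h⟩
    simpa using this
  · obtain ⟨hx, k, hk, k', hk', hkk'⟩ := exists_norm_mul_exp_le hr (fun z hz => hz.1.1) h0
    -- The exit argument for an arbitrary chart of one annulus needs some chart of the other, which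
    -- is where the topological hypothesis enters.
    obtain ⟨Φ₁, hΦ₁⟩ := hA₁.exists_chart
    obtain ⟨Φ₂, hΦ₂⟩ := hA₂.exists_chart
    refine annulusModulus_add_le_of_exit hr hrR he₁ he₂ hA₂.1 hd (by positivity)
      hk.1.1.1.le (hkk'.trans hk'.1.1.2.le) ?_
    rintro Φ (hΦ | hΦ) s
    · exact (hΦ.exists_norm_le_or_le_norm hr hΦ₂ hd he₁ he₂ hk hk' s).imp_right
        fun ⟨y, hy⟩ => ⟨y, hkk'.trans hy⟩
    · have hcomm := Set.union_comm A₁ A₂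
      exact (hΦ.exists_norm_le_or_le_norm hr hΦ₁ hd.symm he₂ he₁ (hcomm ▸ hk) (hcomm ▸ hk')
        s).imp_right fun ⟨y, hy⟩ => ⟨y, hkk'.trans hy⟩
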